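/- Let $(A,\Delta)$ be a multiplier Hopf $^*$-algebra: $A$ is a complex $^*$-algebra, possibly without identity, with non-degenerate product; $\Delta:A\to M(A\otimes A)$ is a non-degenerate coassociative $^*$-homomorphism into the multiplier algebra; and the maps $a\otimes a'\mapsto\Delta(a)(1\otimes a')$ and $a\otimes a'\mapsto(a\otimes1)\Delta(a')$ are bijections of $A\otimes A$ onto $A\otimes A$. Let $\varphi$ be a positive left integral on $A$, i.e. a non-zero linear functional with $\varphi(a^*a)\ge0$ and $(\iota\otimes\varphi)((a'\otimes1)\Delta(a))=\varphi(a)a'$ for all $a,a'\in A$. Let $S$ be the antipode of $A$. Let $B=\hat A=\{\varphi(\,\cdot\,a): a\in A\}$, write $\langle a,b\rangle$ for the value of $b\in B$ at $a\in A$, and let $F:A\to B$, $F(a)=\varphi(\,\cdot\,a)$, be the Fourier transform. The product of $B$ is dual to the coproduct of $A$, $\langle a,bb'\rangle=\langle a_{(1)},b\rangle\langle a_{(2)},b'\rangle$, and $B$ carries the opposite of the coproduct dual to the product of $A$, i.e. $\langle a\otimes a',\Delta(b)\rangle=\langle a'a,b\rangle$. For $a,x\in A$ and $b,y\in B$ put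 $$\pi(a)x=ax,\qquad \lambda(b)x=\langle S^{-1}(x_{(1)}),b\rangle\,x_{(2)},\qquad \pi(b)y=by,\qquad \lambda(a)y=\langle a,y_{(1)}\rangle\,y_{(2)}.$$ Here the Sweedler expressions are read by covering through the pairing: $\lambda(b)x=(\langle S^{-1}(\,\cdot\,),b\rangle\otimes\iota)((e\otimes1)\Delta(x))$ for any $e\in A$ with $\langle S^{-1}(ea'),b\rangle=\langle S^{-1}(a'),b\rangle$ for all $a'\in A$, and $\lambda(a)y=(\langle a,\,\cdot\,\rangle\otimes\iota)(\Delta(y)(e\otimes1))$ for any $e\in B$ with $\langle a,b'e\rangle=\langle a,b'\rangle$ for all $b'\in B$. Then the antipode exists and is a bijection of $A$, the elements $\lambda(b)x\in A$ and $\lambda(a)y\in B$ are well defined (such $e$ exist and the result does not depend on the choice), and for all $a,x\in A$ and $b\in B$ $$F(\pi(a)x)=\lambda(a)F(x),\qquad F(\lambda(b)x)=\pi(b)F(x).$$ -/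

import Mathlib

open scoped TensorProduct ComplexOrder

noncomputable section

namespace QGroup

section MultiplierAlgebra

variable (D : Type*) [NonUnitalRing D] [Module ℂ D] [IsScalarTower ℂ D D] [SMulCommClass ℂ D D]

/-- The multiplier algebra `M(D)` of a (possibly non-unital) complex algebra `D`: pairs `(L, R)`
of linear maps, `L x = m x` and `R x = x m`, with `L (x y) = L x y`, `R (x y) = x R y` and
`(R x) y = x (L y)`. The second component lies in the opposite algebra, so that the product is
`(L₁, R₁) (L₂, R₂) = (L₁ ∘ L₂, R₂ ∘ R₁)`. -/
def Multipliers : Subalgebra ℂ (Module.End ℂ D × (Module.End ℂ D)ᵐᵒᵖ) where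
  carrier := {m | (∀ x y, m.1 (x * y) = m.1 x * y) ∧
    (∀ x y, m.2.unop (x * y) = x * m.2.unop y) ∧ ∀ x y, m.2.unop x * y = x * m.1 y}
  mul_mem' := by
    rintro m n ⟨h1, h2, h3⟩ ⟨k1, k2, k3⟩
    refine ⟨fun x y => ?_, fun x y => ?_, fun x y => ?_⟩ <;> simp [h1, h2, h3, k1, k2, k3]
  add_mem' := by
    rintro m n ⟨h1, h2, h3⟩ ⟨k1, k2, k3⟩
    refine ⟨fun x y => ?_, fun x y => ?_, fun x y => ?_⟩ <;>
      simp [h1, h2, h3, k1, k2, k3, add_mul, mul_add]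
  algebraMap_mem' := by
    intro r
    refine ⟨fun x y => ?_, fun x y => ?_, fun x y => ?_⟩ <;>
      simp [Algebra.algebraMap_eq_smul_one, smul_mul_assoc, mul_smul_comm]

variable {D}

/-- `lmul m x` is the product `m x`. -/
def lmul (m : Multipliers D) : D →ₗ[ℂ] D := m.1.1

/-- `rmul m x` is the product `x m`. -/
def rmul (m : Multipliers D) : D →ₗ[ℂ] D := m.1.2.unop

theorem lmul_mul (m : Multipliers D) (s t : D) : lmul m (s * t) = lmul m s * t := m.2.1 s t

/-- The canonical map `D → M(D)`. -/
def ofMul (d : D) : Multipliers D :=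
  ⟨(LinearMap.mulLeft ℂ d, MulOpposite.op (LinearMap.mulRight ℂ d)),
    fun x y => by simp [mul_assoc], fun x y => by simp [mul_assoc], fun x y => by simp [mul_assoc]⟩

/-- The involution of `M(D)` for a `*`-algebra `D`: `m* x = (x* m)*` and `x m* = (m x*)*`. -/
instance [StarRing D] [StarModule ℂ D] : Star (Multipliers D) where
  star m :=
    ⟨({ toFun := fun x => star (rmul m (star x))
        map_add' := fun x y => by simp
        map_smul' := fun c x => by simp },
      MulOpposite.op
      { toFun := fun x => star (lmul m (star x))
        map_add' := fun x y => by simp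
        map_smul' := fun c x => by simp }), by
      obtain ⟨⟨L, R⟩, h1, h2, h3⟩ := m
      refine ⟨fun x y => ?_, fun x y => ?_, fun x y => ?_⟩
      · exact (congrArg star (by simpa [rmul] using h2 (star y) (star x))).trans (by simp; rfl)
      · exact (congrArg star (by simpa [lmul] using h1 (star y) (star x))).trans (by simp; rfl)
      · have := congrArg star (h3 (star y) (star x))
        simpa [lmul, rmul] using this.symm⟩

end MultiplierAlgebra

section TensorMultipliers

variable {A : Type*} [NonUnitalRing A] [Module ℂ A] [IsScalarTower ℂ A A] [SMulCommClass ℂ A A]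

/-- The multiplier `a ⊗ 1` of `A ⊗ A`. -/
def leftLeg (a : A) : Multipliers (A ⊗[ℂ] A) :=
  ⟨((LinearMap.mulLeft ℂ a).rTensor A, MulOpposite.op ((LinearMap.mulRight ℂ a).rTensor A)), by
    refine ⟨fun x y => ?_, fun x y => ?_, fun x y => ?_⟩ <;>
    · induction x with
      | zero => simp
      | add u v hu hv => simp only [add_mul, map_add, hu, hv]
      | tmul p q =>
        induction y with
        | zero => simp
        | add u v hu hv => simp only [mul_add, map_add, hu, hv]
        | tmul r s => simp [mul_assoc]⟩

/-- The multiplier `1 ⊗ a` of `A ⊗ A`. -/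
def rightLeg (a : A) : Multipliers (A ⊗[ℂ] A) :=
  ⟨((LinearMap.mulLeft ℂ a).lTensor A, MulOpposite.op ((LinearMap.mulRight ℂ a).lTensor A)), by
    refine ⟨fun x y => ?_, fun x y => ?_, fun x y => ?_⟩ <;>
    · induction x with
      | zero => simp
      | add u v hu hv => simp only [add_mul, map_add, hu, hv]
      | tmul p q =>
        induction y with
        | zero => simp
        | add u v hu hv => simp only [mul_add, map_add, hu, hv]
        | tmul r s => simp [mul_assoc]⟩

/-- The slice map `ω ⊗ ι : V ⊗ W → W`. -/
def sliceLeft {V W : Type*} [AddCommGroup V] [Module ℂ V] [AddCommGroup W] [Module ℂ W]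
    (ω : V →ₗ[ℂ] ℂ) : V ⊗[ℂ] W →ₗ[ℂ] W :=
  (TensorProduct.lid ℂ W).toLinearMap ∘ₗ ω.rTensor W

/-- The slice map `ι ⊗ ω : V ⊗ W → V`. -/
def sliceRight {V W : Type*} [AddCommGroup V] [Module ℂ V] [AddCommGroup W] [Module ℂ W]
    (ω : W →ₗ[ℂ] ℂ) : V ⊗[ℂ] W →ₗ[ℂ] V :=
  (TensorProduct.rid ℂ V).toLinearMap ∘ₗ ω.lTensor V

/-- The functional `ω ⊗ ρ` on `V ⊗ W`. -/
def tensorFun {V W : Type*} [AddCommGroup V] [Module ℂ V] [AddCommGroup W] [Module ℂ W]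
    (ω : V →ₗ[ℂ] ℂ) (ρ : W →ₗ[ℂ] ℂ) : V ⊗[ℂ] W →ₗ[ℂ] ℂ :=
  (TensorProduct.lid ℂ ℂ).toLinearMap ∘ₗ TensorProduct.map ω ρ

end TensorMultipliers

/-- A multiplier Hopf `*`-algebra `(A, Δ)`. -/
structure MultiplierHopfStarAlgebra (A : Type*) [NonUnitalRing A] [StarRing A] [Module ℂ A]
    [IsScalarTower ℂ A A] [SMulCommClass ℂ A A] [StarModule ℂ A] where
  /-- The product of `A` is non-degenerate. -/
  nondeg_left : ∀ a : A, (∀ b, b * a = 0) → a = 0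
  nondeg_right : ∀ a : A, (∀ b, a * b = 0) → a = 0
  /-- The comultiplication, a `*`-homomorphism `Δ : A → M(A ⊗ A)`. -/
  comul : A →⋆ₙₐ[ℂ] Multipliers (A ⊗[ℂ] A)
  /-- The comultiplication is non-degenerate: `Δ(A)(A ⊗ A) = A ⊗ A`. -/
  comul_nondeg : Submodule.span ℂ {t | ∃ (a : A) (s : A ⊗[ℂ] A), t = lmul (comul a) s} = ⊤
  /-- The map `a ⊗ a' ↦ Δ(a)(1 ⊗ a')` is a bijection of `A ⊗ A` onto `A ⊗ A ⊆ M(A ⊗ A)`. -/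
  T₁ : A ⊗[ℂ] A ≃ₗ[ℂ] A ⊗[ℂ] A
  T₁_spec : ∀ a a' : A, ofMul (T₁ (a ⊗ₜ a')) = comul a * rightLeg a'
  /-- The map `a ⊗ a' ↦ (a ⊗ 1)Δ(a')` is a bijection of `A ⊗ A` onto `A ⊗ A ⊆ M(A ⊗ A)`. -/
  T₂ : A ⊗[ℂ] A ≃ₗ[ℂ] A ⊗[ℂ] A
  T₂_spec : ∀ a a' : A, ofMul (T₂ (a ⊗ₜ a')) = leftLeg a * comul a'
  /-- Coassociativity `(Δ ⊗ ι)Δ = (ι ⊗ Δ)Δ`, in its usual covered form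
  `(ι ⊗ Δ)((a ⊗ 1)Δ(b)) (1 ⊗ 1 ⊗ c) = (a ⊗ 1 ⊗ 1) (Δ ⊗ ι)(Δ(b)(1 ⊗ c))` in `A ⊗ A ⊗ A`. -/
  coassoc : ∀ a b c : A,
    T₁.toLinearMap.lTensor A (TensorProduct.assoc ℂ A A A (T₂ (a ⊗ₜ b) ⊗ₜ c)) =
      TensorProduct.assoc ℂ A A A
        (T₂.toLinearMap.rTensor A ((TensorProduct.assoc ℂ A A A).symm (a ⊗ₜ T₁ (b ⊗ₜ c))))

/-- An algebraic quantum group: a multiplier Hopf `*`-algebra with a positive left integral `φ`,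
that is, a non-zero positive functional with `(ι ⊗ φ)((a' ⊗ 1)Δ(a)) = φ(a)a'`. -/
structure AlgQuantumGroup (A : Type*) [NonUnitalRing A] [StarRing A] [Module ℂ A]
    [IsScalarTower ℂ A A] [SMulCommClass ℂ A A] [StarModule ℂ A] extends
    MultiplierHopfStarAlgebra A where
  φ : A →ₗ[ℂ] ℂ
  φ_ne_zero : φ ≠ 0
  φ_invariant : ∀ a a' : A, sliceRight φ (T₂ (a' ⊗ₜ a)) = φ a • a'
  φ_positive : ∀ a : A, 0 ≤ φ (star a * a)

section Counit

variable {A : Type*} [NonUnitalRing A] [StarRing A] [Module ℂ A]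
  [IsScalarTower ℂ A A] [SMulCommClass ℂ A A] [StarModule ℂ A] (H : MultiplierHopfStarAlgebra A)

/-- `ε` is the counit: `(ε ⊗ ι)(Δ(a)(1 ⊗ a')) = aa'` and `(ι ⊗ ε)((a ⊗ 1)Δ(a')) = aa'`. -/
def IsCounit (ε : A →ₗ[ℂ] ℂ) : Prop :=
  (∀ a a' : A, sliceLeft ε (H.T₁ (a ⊗ₜ a')) = a * a') ∧
    ∀ a a' : A, sliceRight ε (H.T₂ (a ⊗ₜ a')) = a * a'

/-- `S` is the antipode: `m(S ⊗ ι)(Δ(a)(1 ⊗ a')) = ε(a)a'` and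
`m(ι ⊗ S)((a' ⊗ 1)Δ(a)) = ε(a)a'`, where `m` is the product and `ε` the counit. -/
def IsAntipode (S : A →ₗ[ℂ] A) : Prop :=
  ∃ ε : A →ₗ[ℂ] ℂ, IsCounit H ε ∧
    (∀ a a' : A, LinearMap.mul' ℂ A (S.rTensor A (H.T₁ (a ⊗ₜ a'))) = ε a • a') ∧
    ∀ a a' : A, LinearMap.mul' ℂ A (S.lTensor A (H.T₂ (a' ⊗ₜ a))) = ε a • a'

/-- There is at most one antipode. -/
theorem IsAntipode.unique {S S' : A →ₗ[ℂ] A} (h : IsAntipode H S) (h' : IsAntipode H S') :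
    S = S' := by
  obtain ⟨ε, ⟨e1, -⟩, h1, -⟩ := h
  obtain ⟨ε', ⟨e1', -⟩, h1', -⟩ := h'
  have hs : (sliceLeft ε : A ⊗[ℂ] A →ₗ[ℂ] A) = sliceLeft ε' := by
    rw [← LinearMap.cancel_right H.T₁.surjective]
    exact TensorProduct.ext' fun a b => by simp [e1, e1']
  have hm : LinearMap.mul' ℂ A ∘ₗ S.rTensor A = LinearMap.mul' ℂ A ∘ₗ S'.rTensor A := by
    rw [← LinearMap.cancel_right H.T₁.surjective]
    refine TensorProduct.ext' fun a b => ?_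
    have := LinearMap.congr_fun hs (a ⊗ₜ b)
    simp only [sliceLeft, LinearMap.comp_apply, LinearMap.rTensor_tmul, LinearEquiv.coe_coe,
      TensorProduct.lid_tmul] at this
    simp [h1, h1', this]
  ext a
  refine sub_eq_zero.1 (H.nondeg_right _ fun b => ?_)
  have := LinearMap.congr_fun hm (a ⊗ₜ b)
  simp only [LinearMap.comp_apply, LinearMap.rTensor_tmul, LinearMap.mul'_apply] at this
  rw [sub_mul, this, sub_self]

open Classical in
/-- The antipode `S` of `A`, as a bijection of `A`. -/
def antipode : A ≃ₗ[ℂ] A :=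
  if h : ∃ S : A ≃ₗ[ℂ] A, IsAntipode H S.toLinearMap then h.choose else LinearEquiv.refl ℂ A

end Counit

section NonDegenerate

/-- An element of `V ⊗ W` is zero if all its right slices are zero. -/
theorem eq_zero_of_sliceRight {V W : Type*} [AddCommGroup V] [Module ℂ V] [AddCommGroup W]
    [Module ℂ W] (u : V ⊗[ℂ] W) (h : ∀ g : W →ₗ[ℂ] ℂ, sliceRight g u = 0) : u = 0 := by
  classical
  let b := Module.Basis.ofVectorSpace ℂ W
  refine (TensorProduct.equivFinsuppOfBasisRight b).injective ?_
  rw [map_zero]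
  ext i
  have key : ∀ u : V ⊗[ℂ] W,
      TensorProduct.equivFinsuppOfBasisRight b u i = sliceRight (b.coord i) u := by
    intro u
    induction u with
    | zero => simp
    | add u v hu hv => simp [hu, hv]
    | tmul p q => simp [sliceRight]
  rw [key, h]; rfl

/-- An element of `V ⊗ W` is zero if all its left slices are zero. -/
theorem eq_zero_of_sliceLeft {V W : Type*} [AddCommGroup V] [Module ℂ V] [AddCommGroup W]
    [Module ℂ W] (u : V ⊗[ℂ] W) (h : ∀ g : V →ₗ[ℂ] ℂ, sliceLeft g u = 0) : u = 0 := by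
  refine (TensorProduct.comm ℂ V W).injective ?_
  rw [map_zero]
  refine eq_zero_of_sliceRight _ fun g => ?_
  have key : ∀ u : V ⊗[ℂ] W, sliceRight g (TensorProduct.comm ℂ V W u) = sliceLeft g u := by
    intro u
    induction u with
    | zero => simp
    | add u v hu hv => simp [hu, hv]
    | tmul p q => simp [sliceRight, sliceLeft]
  rw [key, h]

variable {A : Type*} [NonUnitalRing A] [StarRing A] [Module ℂ A]
  [IsScalarTower ℂ A A] [SMulCommClass ℂ A A] [StarModule ℂ A]

/-- The product of `A ⊗ A` is non-degenerate. -/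
theorem tensor_nondeg (H : MultiplierHopfStarAlgebra A) (u : A ⊗[ℂ] A)
    (h : ∀ a b : A, u * (a ⊗ₜ b) = 0) : u = 0 := by
  have e1 : ∀ u : A ⊗[ℂ] A, (∀ a, (LinearMap.mulRight ℂ a).rTensor A u = 0) → u = 0 := by
    intro u hu
    refine eq_zero_of_sliceRight u fun g => H.nondeg_right _ fun a => ?_
    have key : ∀ u : A ⊗[ℂ] A, sliceRight g u * a =
        sliceRight g ((LinearMap.mulRight ℂ a).rTensor A u) := by
      intro u
      induction u with
      | zero => simp
      | add u v hu hv => simp [hu, hv, add_mul]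
      | tmul p q => simp [sliceRight, smul_mul_assoc]
    rw [key, hu, map_zero]
  have e2 : ∀ u : A ⊗[ℂ] A, (∀ a, (LinearMap.mulRight ℂ a).lTensor A u = 0) → u = 0 := by
    intro u hu
    refine eq_zero_of_sliceLeft u fun g => H.nondeg_right _ fun a => ?_
    have key : ∀ u : A ⊗[ℂ] A, sliceLeft g u * a =
        sliceLeft g ((LinearMap.mulRight ℂ a).lTensor A u) := by
      intro u
      induction u with
      | zero => simp
      | add u v hu hv => simp [hu, hv, add_mul]
      | tmul p q => simp [sliceLeft, smul_mul_assoc]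
    rw [key, hu, map_zero]
  refine e2 _ fun b => e1 _ fun a => ?_
  have key : ∀ u : A ⊗[ℂ] A, (LinearMap.mulRight ℂ a).rTensor A
      ((LinearMap.mulRight ℂ b).lTensor A u) = u * (a ⊗ₜ b) := by
    intro u
    induction u with
    | zero => simp
    | add u v hu hv => simp [hu, hv, add_mul]
    | tmul p q => simp
  rw [key, h]

theorem tensor_ext (H : MultiplierHopfStarAlgebra A) {u v : A ⊗[ℂ] A}
    (h : ∀ t, u * t = v * t) : u = v :=
  sub_eq_zero.1 (tensor_nondeg H _ fun a b => by rw [sub_mul, h, sub_self])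

theorem T₁_mul (H : MultiplierHopfStarAlgebra A) (a b : A) (t : A ⊗[ℂ] A) :
    H.T₁ (a ⊗ₜ b) * t = lmul (H.comul a) (lmul (rightLeg b) t) :=
  congrArg (fun m => lmul m t) (H.T₁_spec a b)

theorem T₂_mul (H : MultiplierHopfStarAlgebra A) (a b : A) (t : A ⊗[ℂ] A) :
    H.T₂ (a ⊗ₜ b) * t = lmul (leftLeg a) (lmul (H.comul b) t) :=
  congrArg (fun m => lmul m t) (H.T₂_spec a b)

theorem mul_T₂ (H : MultiplierHopfStarAlgebra A) (a b : A) (t : A ⊗[ℂ] A) :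
    t * H.T₂ (a ⊗ₜ b) = rmul (H.comul b) (rmul (leftLeg a) t) :=
  congrArg (fun m => rmul m t) (H.T₂_spec a b)

theorem star_tensor_mul (u v : A ⊗[ℂ] A) : star (u * v) = star v * star u := by
  induction u with
  | zero => simp
  | add u u' hu hu' => simp only [add_mul, star_add, mul_add, hu, hu']
  | tmul p q =>
    induction v with
    | zero => simp
    | add v v' hv hv' => simp only [add_mul, star_add, mul_add, hv, hv']
    | tmul r s => simp

/-- For all `a, b` there is an element `Δ(b)(a ⊗ 1)` of `A ⊗ A`, and these span `A ⊗ A`. -/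
theorem exists_V (H : MultiplierHopfStarAlgebra A) :
    ∃ V : A ⊗[ℂ] A →ₗ[ℂ] A ⊗[ℂ] A, Function.Surjective V ∧
    ∀ (a b : A) (t : A ⊗[ℂ] A),
      V (a ⊗ₜ b) * t = lmul (H.comul b) (lmul (leftLeg a) t) := by
  refine ⟨{ toFun := fun u => star (H.T₂ (star u))
            map_add' := fun x y => by simp
            map_smul' := fun c x => by simp }, fun u => ?_, fun a b t => ?_⟩
  · exact ⟨star (H.T₂.symm (star u)), by simp⟩
  · have h1 : ∀ x : A ⊗[ℂ] A, lmul (H.comul b) x = star (rmul (H.comul (star b)) (star x)) := by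
      intro x
      have : H.comul b = star (H.comul (star b)) := by rw [← map_star, star_star]
      rw [this]; rfl
    have h2 : ∀ x : A ⊗[ℂ] A, star (lmul (leftLeg a) x) = rmul (leftLeg (star a)) (star x) := by
      intro x
      induction x with
      | zero => simp
      | add u v hu hv => simp only [map_add, star_add, hu, hv]
      | tmul p q => simp [lmul, rmul, leftLeg]
    rw [h1, h2, ← mul_T₂, star_tensor_mul, star_star]
    simp

end NonDegenerate

section Dual

variable {A : Type*} [NonUnitalRing A] [StarRing A] [Module ℂ A]
  [IsScalarTower ℂ A A] [SMulCommClass ℂ A A] [StarModule ℂ A] (G : AlgQuantumGroup A)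

/-- The map `a ↦ φ(· a)` from `A` to its dual space. -/
def fourierMap : A →ₗ[ℂ] (A →ₗ[ℂ] ℂ) where
  toFun a := G.φ ∘ₗ LinearMap.mulRight ℂ a
  map_add' a b := by ext x; simp [mul_add]
  map_smul' c a := by ext x; simp [mul_smul_comm]

/-- The space `B = Â` of functionals `φ(· a)` on `A`, with `a ∈ A`. -/
def DualSpace : Submodule ℂ (A →ₗ[ℂ] ℂ) := LinearMap.range (fourierMap G)

/-- The Fourier transform `F : A → B`, `F(a) = φ(· a)`. -/
def fourier : A →ₗ[ℂ] DualSpace G := (fourierMap G).rangeRestrict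

variable {G} in
/-- An element `p ∈ A` with `F(p) = b`. -/
def rep (b : DualSpace G) : A := b.2.choose

variable {G} in
theorem fourier_rep (b : DualSpace G) : fourier G (rep b) = b := Subtype.ext b.2.choose_spec

variable {G} in
/-- Evaluation `⟨a, ·⟩` of elements of `B` at `a ∈ A`. -/
def evalAt (a : A) : DualSpace G →ₗ[ℂ] ℂ := LinearMap.applyₗ a ∘ₗ (DualSpace G).subtype

/-- The functional `x ↦ (ω ⊗ e)(Δ(x)) = ω(x₁)e(x₂)` for `e ∈ B`. If `e = φ(· p)`, then `x₂` is
covered by `p`, and the value is `(ω ⊗ φ)(Δ(x)(1 ⊗ p))`. -/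
def conv (ω : A →ₗ[ℂ] ℂ) (e : DualSpace G) : A →ₗ[ℂ] ℂ :=
  tensorFun ω G.φ ∘ₗ G.T₁.toLinearMap ∘ₗ (TensorProduct.mk ℂ A A).flip (rep e)

/-- If `ω = ω'(· r)`, the value of `conv` is `(ω' ⊗ φ)(Δ(x)(r ⊗ p))` for every `p` with
`e = φ(· p)`. -/
theorem conv_apply (ω : A →ₗ[ℂ] ℂ) (r p x : A) :
    conv G (ω ∘ₗ LinearMap.mulRight ℂ r) (fourier G p) x =
      tensorFun ω G.φ (lmul (G.comul x) (r ⊗ₜ p)) := by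
  have h1 : ∀ q : A, tensorFun (ω ∘ₗ LinearMap.mulRight ℂ r) G.φ (G.T₁ (x ⊗ₜ q)) =
      tensorFun ω G.φ (lmul (G.comul x) (r ⊗ₜ q)) := by
    intro q
    have key : ∀ u : A ⊗[ℂ] A, tensorFun (ω ∘ₗ LinearMap.mulRight ℂ r) G.φ u =
        tensorFun ω G.φ (rmul (leftLeg r) u) := by
      intro u
      induction u with
      | zero => simp
      | add u v hu hv => simp [hu, hv]
      | tmul a b => simp [tensorFun, rmul, leftLeg]
    rw [key]
    congr 1
    refine tensor_ext G.toMultiplierHopfStarAlgebra fun t => ?_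
    rw [← lmul_mul, show rmul (leftLeg r) (G.T₁ (x ⊗ₜ q)) * t =
      G.T₁ (x ⊗ₜ q) * lmul (leftLeg r) t from (leftLeg r).2.2.2 _ _, T₁_mul]
    congr 1
    induction t with
    | zero => simp
    | add u v hu hv => simp only [map_add, mul_add, hu, hv]
    | tmul a b => simp [lmul, rightLeg, leftLeg]
  obtain ⟨V, -, hV⟩ := exists_V G.toMultiplierHopfStarAlgebra
  have h2 : ∀ q : A, tensorFun ω G.φ (lmul (G.comul x) (r ⊗ₜ q)) =
      tensorFun ω (fourierMap G q) (V (r ⊗ₜ x)) := by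
    intro q
    have key : ∀ u : A ⊗[ℂ] A, tensorFun ω (fourierMap G q) u =
        tensorFun ω G.φ (rmul (rightLeg q) u) := by
      intro u
      induction u with
      | zero => simp
      | add u v hu hv => simp [hu, hv]
      | tmul a b => simp [tensorFun, rmul, rightLeg, fourierMap]
    rw [key]
    congr 1
    refine tensor_ext G.toMultiplierHopfStarAlgebra fun t => ?_
    rw [← lmul_mul, show rmul (rightLeg q) (V (r ⊗ₜ x)) * t =
      V (r ⊗ₜ x) * lmul (rightLeg q) t from (rightLeg q).2.2.2 _ _, hV]
    congr 1
    induction t with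
    | zero => simp
    | add u v hu hv => simp only [map_add, mul_add, hu, hv]
    | tmul a b => simp [lmul, rightLeg, leftLeg]
  have h3 : fourierMap G (rep (fourier G p)) = fourierMap G p :=
    congrArg Subtype.val (fourier_rep (fourier G p))
  calc conv G (ω ∘ₗ LinearMap.mulRight ℂ r) (fourier G p) x
      = tensorFun (ω ∘ₗ LinearMap.mulRight ℂ r) G.φ (G.T₁ (x ⊗ₜ rep (fourier G p))) := rfl
    _ = _ := by rw [h1, h2, h3, ← h2]

/-- By left invariance, `Δ(x)s` can be integrated over the second leg. -/
theorem exists_integral (s : A ⊗[ℂ] A) : ∃ u : A ⊗[ℂ] A, ∀ (ω : A →ₗ[ℂ] ℂ) (x : A),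
    tensorFun ω G.φ (lmul (G.comul x) s) =
      tensorFun ω (G.φ ∘ₗ LinearMap.mulLeft ℂ x) u := by
  obtain ⟨V, hs, hV⟩ := exists_V G.toMultiplierHopfStarAlgebra
  obtain ⟨u, rfl⟩ := hs s
  refine ⟨u, fun ω x => ?_⟩
  induction u with
  | zero => simp
  | add u v hu hv => simp only [map_add, hu, hv]
  | tmul k p =>
    have h1 : lmul (G.comul x) (V (k ⊗ₜ p)) = V (k ⊗ₜ (x * p)) := by
      refine tensor_ext G.toMultiplierHopfStarAlgebra fun t => ?_
      rw [← lmul_mul, hV, hV, map_mul]; rfl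
    have h2 : ∀ q, sliceRight G.φ (V (k ⊗ₜ q)) = G.φ q • k := by
      intro q
      refine sub_eq_zero.1 (G.nondeg_left _ fun y => ?_)
      have h3 : ∀ u : A ⊗[ℂ] A, y * sliceRight G.φ u = sliceRight G.φ (lmul (leftLeg y) u) := by
        intro u
        induction u with
        | zero => simp
        | add u v hu hv => simp [hu, hv, mul_add]
        | tmul a b => simp [sliceRight, lmul, leftLeg, mul_smul_comm]
      have h4 : ∀ u : A ⊗[ℂ] A, sliceRight G.φ (rmul (leftLeg k) u) = sliceRight G.φ u * k := by
        intro u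
        induction u with
        | zero => simp
        | add u v hu hv => simp [hu, hv, add_mul]
        | tmul a b => simp [sliceRight, rmul, leftLeg, smul_mul_assoc]
      have h5 : lmul (leftLeg y) (V (k ⊗ₜ q)) = rmul (leftLeg k) (G.T₂ (y ⊗ₜ q)) := by
        refine tensor_ext G.toMultiplierHopfStarAlgebra fun t => ?_
        rw [← lmul_mul, hV, show rmul (leftLeg k) (G.T₂ (y ⊗ₜ q)) * t =
          G.T₂ (y ⊗ₜ q) * lmul (leftLeg k) t from (leftLeg k).2.2.2 _ _, T₂_mul]
      rw [mul_sub, h3, h5, h4, G.φ_invariant, smul_mul_assoc, mul_smul_comm, sub_self]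
    have h6 : ∀ u : A ⊗[ℂ] A, tensorFun ω G.φ u = ω (sliceRight G.φ u) := by
      intro u
      induction u with
      | zero => simp
      | add u v hu hv => simp [hu, hv]
      | tmul a b => simp [tensorFun, sliceRight, mul_comm]
    rw [h1, h6, h2]
    simp [tensorFun, mul_comm]

/-- The functional `conv` for two elements of `B` is again in `B`. -/
theorem conv_mem (b c : DualSpace G) : conv G b.1 c ∈ DualSpace G := by
  obtain ⟨_, r, rfl⟩ := b
  obtain ⟨p, rfl⟩ : ∃ p, fourier G p = c := ⟨rep c, fourier_rep c⟩
  obtain ⟨u, hu⟩ := exists_integral G (r ⊗ₜ p)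
  refine ⟨sliceLeft G.φ u, LinearMap.ext fun x => ?_⟩
  refine Eq.trans ?_ ((conv_apply G G.φ r p x).trans (hu G.φ x)).symm
  have key : ∀ u : A ⊗[ℂ] A, fourierMap G (sliceLeft G.φ u) x =
      tensorFun G.φ (G.φ ∘ₗ LinearMap.mulLeft ℂ x) u := by
    intro u
    induction u with
    | zero => simp
    | add u v hu hv => simp only [map_add, LinearMap.add_apply, hu, hv]
    | tmul a b => simp [tensorFun, sliceLeft, fourierMap]
  exact key u

variable {G} in
/-- The product of `B`, dual to the comultiplication of `A`: `⟨x, bc⟩ = ⟨x₁, b⟩⟨x₂, c⟩`. -/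
def dualMul (b c : DualSpace G) : DualSpace G := ⟨conv G b.1 c, conv_mem G b c⟩

/-- Elements of `B ⊗ B` are determined by their pairing with the elements `x ⊗ x'`. -/
theorem dual_tensor_ext {t t' : DualSpace G ⊗[ℂ] DualSpace G}
    (h : ∀ x x' : A, tensorFun (evalAt x) (evalAt x') t = tensorFun (evalAt x) (evalAt x') t') :
    t = t' := by
  refine sub_eq_zero.1 ?_
  have h0 : ∀ x x' : A, tensorFun (evalAt x) (evalAt x') (t - t') = 0 := fun x x' => by
    rw [map_sub, h, sub_self]
  generalize t - t' = s at h0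
  have h1 : ∀ (x : A), sliceLeft (evalAt x) s = 0 := by
    intro x
    refine Subtype.ext (LinearMap.ext fun x' => ?_)
    have key : ∀ s : DualSpace G ⊗[ℂ] DualSpace G, (sliceLeft (evalAt x) s).1 x' =
        tensorFun (evalAt x) (evalAt x') s := by
      intro s
      induction s with
      | zero => simp
      | add u v hu hv => simp [hu, hv]
      | tmul a b => simp [tensorFun, sliceLeft, evalAt]
    exact (key s).trans (h0 x x')
  refine eq_zero_of_sliceRight s fun g => Subtype.ext (LinearMap.ext fun x => ?_)
  have key : ∀ s : DualSpace G ⊗[ℂ] DualSpace G, (sliceRight g s).1 x =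
      g (sliceLeft (evalAt x) s) := by
    intro s
    induction s with
    | zero => simp
    | add u v hu hv => simp [hu, hv]
    | tmul a b => simp [sliceRight, sliceLeft, evalAt, mul_comm]
  rw [key, h1, map_zero]; rfl

/-- The comultiplication of `B` is the opposite of the one dual to the product of `A`, so
`⟨x ⊗ x', Δ(y)⟩ = ⟨x'x, y⟩`. Hence `Δ(y)(e ⊗ 1)` has to be the element `t` of `B ⊗ B` with
`⟨x ⊗ x', t⟩ = ⟨x₁, y₁⟩⟨x₂, e⟩⟨x', y₂⟩ = ⟨x'x₁, y⟩⟨x₂, e⟩`. It exists. -/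
theorem exists_dualComul (y e : DualSpace G) : ∃ t : DualSpace G ⊗[ℂ] DualSpace G,
    ∀ x x' : A, tensorFun (evalAt x) (evalAt x') t =
      conv G (y.1 ∘ₗ LinearMap.mulLeft ℂ x') e x := by
  obtain ⟨_, r, rfl⟩ := y
  obtain ⟨p, rfl⟩ : ∃ p, fourier G p = e := ⟨rep e, fourier_rep e⟩
  obtain ⟨u, hu⟩ := exists_integral G (r ⊗ₜ p)
  refine ⟨TensorProduct.map (fourier G) (fourier G) (TensorProduct.comm ℂ A A u),
    fun x x' => ?_⟩
  have h1 : (fourierMap G r) ∘ₗ LinearMap.mulLeft ℂ x' =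
      (G.φ ∘ₗ LinearMap.mulLeft ℂ x') ∘ₗ LinearMap.mulRight ℂ r :=
    LinearMap.ext fun z => by simp [fourierMap, mul_assoc]
  refine Eq.trans ?_ (((congrArg (fun ω => conv G ω (fourier G p) x) h1).trans
    (conv_apply G _ r p x)).trans (hu _ x)).symm
  have key : ∀ u : A ⊗[ℂ] A, tensorFun (evalAt x) (evalAt x')
      (TensorProduct.map (fourier G) (fourier G) (TensorProduct.comm ℂ A A u)) =
      tensorFun (G.φ ∘ₗ LinearMap.mulLeft ℂ x') (G.φ ∘ₗ LinearMap.mulLeft ℂ x) u := by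
    intro u
    induction u with
    | zero => simp
    | add u v hu hv => simp only [map_add, hu, hv]
    | tmul a b => exact mul_comm (G.φ (x * b)) (G.φ (x' * a))
  exact key u

variable {G} in
/-- The element `Δ(y)(e ⊗ 1) = y₁e ⊗ y₂` of `B ⊗ B`. -/
def dualComul (y e : DualSpace G) : DualSpace G ⊗[ℂ] DualSpace G :=
  (exists_dualComul G y e).choose

/-- `z = λ(b)x = ⟨S⁻¹(x₁), b⟩x₂`, where `x₁` is covered by `b` through the pairing: there is
`e ∈ A` with `⟨S⁻¹(a), b⟩ = ⟨S⁻¹(ea), b⟩` for all `a`, so `λ(b)x = ⟨S⁻¹(ex₁), b⟩x₂`, a slice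
of `(e ⊗ 1)Δ(x)`. -/
def IsConvolution (b : DualSpace G) (x z : A) : Prop :=
  ∃ e : A, (∀ a : A, b.1 ((antipode G.toMultiplierHopfStarAlgebra).symm (e * a)) =
      b.1 ((antipode G.toMultiplierHopfStarAlgebra).symm a)) ∧
    z = sliceLeft (b.1 ∘ₗ (antipode G.toMultiplierHopfStarAlgebra).symm.toLinearMap)
      (G.T₂ (e ⊗ₜ x))

/-- `z = λ(a)y = ⟨a, y₁⟩y₂`, where `y₁` is covered by `a` through the pairing: there is `e ∈ B`
with `⟨a, b⟩ = ⟨a, be⟩` for all `b`, so `λ(a)y = ⟨a, y₁e⟩y₂`, a slice of `Δ(y)(e ⊗ 1)`. -/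
def IsDualConvolution (a : A) (y z : DualSpace G) : Prop :=
  ∃ e : DualSpace G, (∀ b : DualSpace G, evalAt a (dualMul b e) = evalAt a b) ∧
    z = sliceLeft (evalAt a) (dualComul y e)

open Classical in
variable {G} in
/-- The operator `λ(b)` on `A`. -/
def lam (b : DualSpace G) (x : A) : A :=
  if h : ∃ z, IsConvolution G b x z then h.choose else 0

open Classical in
variable {G} in
/-- The operator `λ(a)` on `B`. -/
def dualLam (a : A) (y : DualSpace G) : DualSpace G :=
  if h : ∃ z, IsDualConvolution G a y z then h.choose else 0

/-- The operator `π(a)` on `A`. -/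
def mulOp (a x : A) : A := a * x

variable {G} in
/-- The operator `π(b)` on `B`. -/
def dualMulOp (b y : DualSpace G) : DualSpace G := dualMul b y

end Dual

end QGroup

end

/-! Both formulas come down to the element c₁φ(c₂x) of A, written `intT₁ G (c ⊗ₜ x)`. In these terms
the product of B is ⟨c, b F(x)⟩ = b(c₁φ(c₂x)). The key fact is the strong left invariance
S(c₁φ(c₂x)) = x₁φ(cx₂) (`antipode_intT₁`). It gives φ(c λ(b)x) = b(S⁻¹(x₁φ(cx₂))) = b(c₁φ(c₂x)),
which is the second formula. The first is ⟨x, λ(a)F(r)⟩ = ⟨xa, F(r)⟩ = φ(xar), once a is covered.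

The work lies in having S and the covers. The counit ε comes from coassociativity
(`tmul_mul'_T₁_symm`). Left invariance shows that x₁φ(cx₂) depends only on c₁φ(c₂x) (`T₁_intT₁`,
`intT₃_mul_eq_counit`), so strong invariance can serve as the definition of S. Positivity makes φ
hermitian, whence S(S(a)*) = a* and S is bijective. Injectivity of S makes φ faithful
(`φ_faithful`).

The covers are found by separating a vector from a subspace with a functional (`exists_mul_eq_self`,
`exists_intT₁_eq_self`). Independence of the cover follows from non-degeneracy of the product on the
A side and from faithfulness of φ on the B side. -/

noncomputable section

namespace QGroup

/-! ### Identities between covered coproducts, checked in M(A ⊗ A) -/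

section Covering

variable {A : Type*} [NonUnitalRing A] [StarRing A] [Module ℂ A]
  [IsScalarTower ℂ A A] [SMulCommClass ℂ A A] [StarModule ℂ A] (H : MultiplierHopfStarAlgebra A)

/-- Left multiplication determines right multiplication, because (t m)s = t(m s) and the product of
A ⊗ A is non-degenerate. -/
theorem multiplier_ext (H : MultiplierHopfStarAlgebra A) {m n : Multipliers (A ⊗[ℂ] A)}
    (h : ∀ t, lmul m t = lmul n t) : m = n := by
  have hR : ∀ t, rmul m t = rmul n t := fun t =>
    tensor_ext H fun s => by
      rw [show rmul m t * s = t * lmul m s from m.2.2.2 _ _,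
        show rmul n t * s = t * lmul n s from n.2.2.2 _ _, h]
  exact Subtype.ext (Prod.ext (LinearMap.ext h) (MulOpposite.unop_injective (LinearMap.ext hR)))

theorem lmul_mul_apply {D : Type*} [NonUnitalRing D] [Module ℂ D] [IsScalarTower ℂ D D]
    [SMulCommClass ℂ D D] (m n : Multipliers D) (t : D) : lmul (m * n) t = lmul m (lmul n t) := rfl

theorem lmul_ofMul {D : Type*} [NonUnitalRing D] [Module ℂ D] [IsScalarTower ℂ D D]
    [SMulCommClass ℂ D D] (d t : D) : lmul (ofMul d) t = d * t := rfl

theorem ofMul_injective (H : MultiplierHopfStarAlgebra A) {u v : A ⊗[ℂ] A} (h : ofMul u = ofMul v) : u = v :=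
  tensor_ext H fun t => congrArg (fun m => lmul m t) h

theorem ofMul_lmul (H : MultiplierHopfStarAlgebra A) (m : Multipliers (A ⊗[ℂ] A)) (u : A ⊗[ℂ] A) :
    ofMul (lmul m u) = m * ofMul u :=
  multiplier_ext H fun t => by rw [lmul_mul_apply, lmul_ofMul, lmul_ofMul, lmul_mul]

theorem ofMul_rmul (H : MultiplierHopfStarAlgebra A) (m : Multipliers (A ⊗[ℂ] A)) (u : A ⊗[ℂ] A) :
    ofMul (rmul m u) = ofMul u * m :=
  multiplier_ext H fun t => by
    rw [lmul_mul_apply, lmul_ofMul, lmul_ofMul]; exact m.2.2.2 _ _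

theorem rightLeg_mul_leftLeg (H : MultiplierHopfStarAlgebra A) (a b : A) :
    rightLeg b * leftLeg a = (ofMul (a ⊗ₜ b) : Multipliers (A ⊗[ℂ] A)) := by
  refine multiplier_ext H fun t => ?_
  rw [lmul_mul_apply, lmul_ofMul]
  induction t with
  | zero => simp
  | add u v hu hv => simp only [map_add, mul_add, hu, hv]
  | tmul p q => simp [lmul, leftLeg, rightLeg]

theorem leftLeg_mul_rightLeg (H : MultiplierHopfStarAlgebra A) (a b : A) :
    leftLeg a * rightLeg b = (ofMul (a ⊗ₜ b) : Multipliers (A ⊗[ℂ] A)) := by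
  refine multiplier_ext H fun t => ?_
  rw [lmul_mul_apply, lmul_ofMul]
  induction t with
  | zero => simp
  | add u v hu hv => simp only [map_add, mul_add, hu, hv]
  | tmul p q => simp [lmul, leftLeg, rightLeg]

theorem leftLeg_rightLeg_comm (H : MultiplierHopfStarAlgebra A) (a b : A) :
    leftLeg a * rightLeg b = (rightLeg b * leftLeg a : Multipliers (A ⊗[ℂ] A)) := by
  rw [leftLeg_mul_rightLeg H, rightLeg_mul_leftLeg H]

/-- The map `c ⊗ x ↦ (1 ⊗ c)Δ(x)`. -/
def T₃ : A ⊗[ℂ] A →ₗ[ℂ] A ⊗[ℂ] A where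
  toFun u := star (H.T₁ (TensorProduct.comm ℂ A A (star u)))
  map_add' x y := by simp
  map_smul' c x := by simp

theorem star_T₃ (c x : A) : star (T₃ H (c ⊗ₜ x)) = H.T₁ (star x ⊗ₜ star c) := by
  simp [T₃]

theorem lmul_comul_eq_star (b : A) (x : A ⊗[ℂ] A) :
    lmul (H.comul b) x = star (rmul (H.comul (star b)) (star x)) := by
  have : H.comul b = star (H.comul (star b)) := by rw [← map_star, star_star]
  rw [this]; rfl

/-- As Δ preserves the involution, (1 ⊗ c)Δ(x) is the adjoint of Δ(x*)(1 ⊗ c*). -/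
theorem T₃_spec (c x : A) : ofMul (T₃ H (c ⊗ₜ x)) = rightLeg c * H.comul x := by
  refine multiplier_ext H fun t => ?_
  have h2 : ∀ x : A ⊗[ℂ] A, lmul (rightLeg c) x = star (rmul (rightLeg (star c)) (star x)) := by
    intro x
    induction x with
    | zero => simp
    | add u v hu hv => simp only [map_add, star_add, hu, hv]
    | tmul p q => simp [lmul, rmul, rightLeg]
  have h3 : star t * H.T₁ (star x ⊗ₜ star c) =
      rmul (rightLeg (star c)) (rmul (H.comul (star x)) (star t)) :=
    congrArg (fun m => rmul m (star t)) (H.T₁_spec (star x) (star c))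
  rw [lmul_ofMul, lmul_mul_apply, lmul_comul_eq_star, h2, star_star, ← h3, ← star_T₃,
    ← star_tensor_mul, star_star]

/-- The map `a ⊗ b ↦ Δ(b)(a ⊗ 1)`. -/
def T₄ : A ⊗[ℂ] A →ₗ[ℂ] A ⊗[ℂ] A := (exists_V H).choose

theorem T₄_spec (a b : A) : ofMul (T₄ H (a ⊗ₜ b)) = H.comul b * leftLeg a :=
  multiplier_ext H fun t => (exists_V H).choose_spec.2 a b t

/-- Both sides are `(a ⊗ 1)Δ(p)(1 ⊗ r)`. -/
theorem leftLeg_T₁ (a p r : A) :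
    lmul (leftLeg a) (H.T₁ (p ⊗ₜ r)) = rmul (rightLeg r) (H.T₂ (a ⊗ₜ p)) := by
  apply ofMul_injective H
  rw [ofMul_lmul H, ofMul_rmul H, H.T₁_spec, H.T₂_spec, mul_assoc]

theorem leftLeg_T₁_eq (a p r : A) :
    lmul (leftLeg a) (H.T₁ (p ⊗ₜ r)) = (LinearMap.mul' ℂ A).lTensor A
      (TensorProduct.assoc ℂ A A A (H.T₂ (a ⊗ₜ p) ⊗ₜ r)) := by
  rw [leftLeg_T₁]
  generalize H.T₂ (a ⊗ₜ p) = u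
  induction u with
  | zero => simp
  | add u v hu hv => simp only [map_add, TensorProduct.add_tmul, hu, hv]
  | tmul p q => simp [rmul, rightLeg]

theorem rmul_leftLeg_T₁ (q s r : A) :
    rmul (leftLeg r) (H.T₁ (q ⊗ₜ s)) = lmul (H.comul q) (r ⊗ₜ s) := by
  apply ofMul_injective H
  rw [ofMul_lmul H, ofMul_rmul H, H.T₁_spec, mul_assoc, rightLeg_mul_leftLeg H]

theorem lmul_comul_T₄ (q y x : A) :
    lmul (H.comul q) (T₄ H (y ⊗ₜ x)) = T₄ H (y ⊗ₜ (q * x)) := by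
  apply ofMul_injective H
  rw [ofMul_lmul H, T₄_spec, T₄_spec, map_mul, mul_assoc]

theorem rightLeg_T₄ (c x y : A) :
    lmul (rightLeg c) (T₄ H (y ⊗ₜ x)) = rmul (leftLeg y) (T₃ H (c ⊗ₜ x)) := by
  apply ofMul_injective H
  rw [ofMul_lmul H, ofMul_rmul H, T₄_spec, T₃_spec, mul_assoc]

theorem rightLeg_T₂ (c e x : A) :
    lmul (rightLeg c) (H.T₂ (e ⊗ₜ x)) = lmul (leftLeg e) (T₃ H (c ⊗ₜ x)) := by
  apply ofMul_injective H
  rw [ofMul_lmul H, ofMul_lmul H, H.T₂_spec, T₃_spec, ← mul_assoc, ← mul_assoc,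
    leftLeg_rightLeg_comm H]

theorem leftLeg_T₄ (a y x : A) :
    lmul (leftLeg a) (T₄ H (y ⊗ₜ x)) = rmul (leftLeg y) (H.T₂ (a ⊗ₜ x)) := by
  apply ofMul_injective H
  rw [ofMul_lmul H, ofMul_rmul H, T₄_spec, H.T₂_spec, mul_assoc]

end Covering

/-! ### Slice maps and multiplication on one leg -/

section Slices

variable {A : Type*} [NonUnitalRing A] [Module ℂ A] [IsScalarTower ℂ A A] [SMulCommClass ℂ A A]

theorem sliceLeft_tmul {V W : Type*} [AddCommGroup V] [Module ℂ V] [AddCommGroup W] [Module ℂ W]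
    (ω : V →ₗ[ℂ] ℂ) (v : V) (w : W) : sliceLeft ω (v ⊗ₜ w) = ω v • w := by simp [sliceLeft]

theorem sliceRight_tmul {V W : Type*} [AddCommGroup V] [Module ℂ V] [AddCommGroup W] [Module ℂ W]
    (ω : W →ₗ[ℂ] ℂ) (v : V) (w : W) : sliceRight ω (v ⊗ₜ w) = ω w • v := by simp [sliceRight]

theorem tensorFun_eq_sliceRight {V W : Type*} [AddCommGroup V] [Module ℂ V] [AddCommGroup W]
    [Module ℂ W] (ω : V →ₗ[ℂ] ℂ) (ρ : W →ₗ[ℂ] ℂ) (u : V ⊗[ℂ] W) :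
    tensorFun ω ρ u = ω (sliceRight ρ u) := by
  induction u with
  | zero => simp
  | add u v hu hv => simp [hu, hv]
  | tmul a b => simp [tensorFun, sliceRight, mul_comm]

theorem tensorFun_eq_sliceLeft {V W : Type*} [AddCommGroup V] [Module ℂ V] [AddCommGroup W]
    [Module ℂ W] (ω : V →ₗ[ℂ] ℂ) (ρ : W →ₗ[ℂ] ℂ) (u : V ⊗[ℂ] W) :
    tensorFun ω ρ u = ρ (sliceLeft ω u) := by
  induction u with
  | zero => simp
  | add u v hu hv => simp [hu, hv]
  | tmul a b => simp [tensorFun, sliceLeft]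

theorem sliceRight_leftLeg (ω : A →ₗ[ℂ] ℂ) (a : A) (u : A ⊗[ℂ] A) :
    sliceRight ω (lmul (leftLeg a) u) = a * sliceRight ω u := by
  induction u with
  | zero => simp
  | add u v hu hv => simp [hu, hv, mul_add]
  | tmul p q => simp [sliceRight, lmul, leftLeg, mul_smul_comm]

theorem sliceRight_rmul_leftLeg (ω : A →ₗ[ℂ] ℂ) (a : A) (u : A ⊗[ℂ] A) :
    sliceRight ω (rmul (leftLeg a) u) = sliceRight ω u * a := by
  induction u with
  | zero => simp
  | add u v hu hv => simp [hu, hv, add_mul]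
  | tmul p q => simp [sliceRight, rmul, leftLeg, smul_mul_assoc]

theorem sliceRight_rightLeg (ω : A →ₗ[ℂ] ℂ) (a : A) (u : A ⊗[ℂ] A) :
    sliceRight ω (lmul (rightLeg a) u) = sliceRight (ω ∘ₗ LinearMap.mulLeft ℂ a) u := by
  induction u with
  | zero => simp
  | add u v hu hv => simp only [map_add, hu, hv]
  | tmul p q => simp [sliceRight, lmul, rightLeg]

theorem sliceRight_rmul_rightLeg (ω : A →ₗ[ℂ] ℂ) (a : A) (u : A ⊗[ℂ] A) :
    sliceRight ω (rmul (rightLeg a) u) = sliceRight (ω ∘ₗ LinearMap.mulRight ℂ a) u := by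
  induction u with
  | zero => simp
  | add u v hu hv => simp only [map_add, hu, hv]
  | tmul p q => simp [sliceRight, rmul, rightLeg]

theorem sliceLeft_leftLeg (ω : A →ₗ[ℂ] ℂ) (a : A) (u : A ⊗[ℂ] A) :
    sliceLeft ω (lmul (leftLeg a) u) = sliceLeft (ω ∘ₗ LinearMap.mulLeft ℂ a) u := by
  induction u with
  | zero => simp
  | add u v hu hv => simp only [map_add, hu, hv]
  | tmul p q => simp [sliceLeft, lmul, leftLeg]

theorem sliceLeft_rmul_leftLeg (ω : A →ₗ[ℂ] ℂ) (a : A) (u : A ⊗[ℂ] A) :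
    sliceLeft ω (rmul (leftLeg a) u) = sliceLeft (ω ∘ₗ LinearMap.mulRight ℂ a) u := by
  induction u with
  | zero => simp
  | add u v hu hv => simp only [map_add, hu, hv]
  | tmul p q => simp [sliceLeft, rmul, leftLeg]

theorem sliceLeft_rightLeg (ω : A →ₗ[ℂ] ℂ) (a : A) (u : A ⊗[ℂ] A) :
    sliceLeft ω (lmul (rightLeg a) u) = a * sliceLeft ω u := by
  induction u with
  | zero => simp
  | add u v hu hv => simp [hu, hv, mul_add]
  | tmul p q => simp [sliceLeft, lmul, rightLeg, mul_smul_comm]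

theorem sliceLeft_rmul_rightLeg (ω : A →ₗ[ℂ] ℂ) (a : A) (u : A ⊗[ℂ] A) :
    sliceLeft ω (rmul (rightLeg a) u) = sliceLeft ω u * a := by
  induction u with
  | zero => simp
  | add u v hu hv => simp [hu, hv, add_mul]
  | tmul p q => simp [sliceLeft, rmul, rightLeg, smul_mul_assoc]

theorem sliceRight_zero {V W : Type*} [AddCommGroup V] [Module ℂ V] [AddCommGroup W]
    [Module ℂ W] (u : V ⊗[ℂ] W) : sliceRight (0 : W →ₗ[ℂ] ℂ) u = 0 := by simp [sliceRight]

theorem sliceLeft_zero {V W : Type*} [AddCommGroup V] [Module ℂ V] [AddCommGroup W]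
    [Module ℂ W] (u : V ⊗[ℂ] W) : sliceLeft (0 : V →ₗ[ℂ] ℂ) u = 0 := by simp [sliceLeft]

/-- Allows an identity for T₁ to be tested after multiplying by a ⊗ 1, where coassociativity is
available in its covered form. -/
theorem tensor_ext_leftLeg {A : Type*} [NonUnitalRing A] [StarRing A] [Module ℂ A]
    [IsScalarTower ℂ A A] [SMulCommClass ℂ A A] [StarModule ℂ A] (H : MultiplierHopfStarAlgebra A)
    {u v : A ⊗[ℂ] A}
    (h : ∀ a : A, lmul (leftLeg a) u = lmul (leftLeg a) v) : u = v := by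
  refine sub_eq_zero.1 (eq_zero_of_sliceRight _ fun g => H.nondeg_left _ fun a => ?_)
  rw [← sliceRight_leftLeg, map_sub, h, sub_self, map_zero]

end Slices


theorem exists_dual_eq_one {V : Type*} [AddCommGroup V] [Module ℂ V] {a : V} (ha : a ≠ 0) : ∃ f : V →ₗ[ℂ] ℂ, f a = 1 := by
  obtain ⟨f, hf⟩ : ∃ f : V →ₗ[ℂ] ℂ, f a ≠ 0 := by
    by_contra! h
    exact ha ((Module.forall_dual_apply_eq_zero_iff ℂ a).1 h)
  exact ⟨(f a)⁻¹ • f, by simp [hf]⟩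

/-! ### The counit, and multiplicativity by means of Δ(ab) = Δ(a)Δ(b) -/

section CounitExistence

variable {A : Type*} [NonUnitalRing A] [StarRing A] [Module ℂ A]
  [IsScalarTower ℂ A A] [SMulCommClass ℂ A A] [StarModule ℂ A] {H : MultiplierHopfStarAlgebra A}

/-- `(ι ⊗ T₁⁻¹)(T₂ ⊗ ι) = (T₂ ⊗ ι)(ι ⊗ T₁⁻¹)`. -/
theorem lTensor_T₁_symm_T₂ (H : MultiplierHopfStarAlgebra A) (a b c : A) :
    H.T₁.symm.toLinearMap.lTensor A (TensorProduct.assoc ℂ A A A (H.T₂ (a ⊗ₜ b) ⊗ₜ c)) =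
      TensorProduct.assoc ℂ A A A
        (H.T₂.toLinearMap.rTensor A
          ((TensorProduct.assoc ℂ A A A).symm (a ⊗ₜ H.T₁.symm (b ⊗ₜ c)))) := by
  have h1 : ∀ w : A ⊗[ℂ] A, H.T₁.toLinearMap.lTensor A (TensorProduct.assoc ℂ A A A
      (H.T₂.toLinearMap.rTensor A ((TensorProduct.assoc ℂ A A A).symm (a ⊗ₜ w)))) =
      TensorProduct.assoc ℂ A A A
        (H.T₂.toLinearMap.rTensor A ((TensorProduct.assoc ℂ A A A).symm (a ⊗ₜ H.T₁ w))) := by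
    intro w
    induction w with
    | zero => simp
    | add u v hu hv => simp only [map_add, TensorProduct.tmul_add, hu, hv]
    | tmul p q => simpa using H.coassoc a p q
  have h2 : ∀ w : A ⊗[ℂ] (A ⊗[ℂ] A),
      H.T₁.symm.toLinearMap.lTensor A (H.T₁.toLinearMap.lTensor A w) = w := by
    intro w
    rw [← LinearMap.lTensor_comp_apply]
    simp
  rw [← h2 (TensorProduct.assoc ℂ A A A (H.T₂.toLinearMap.rTensor A _)), h1]
  simp

/-- Write a ⊗ b as T₂(Σ p ⊗ q). Commuting T₁⁻¹ past T₂ and multiplying the last two legs leaves Σ (p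
⊗ 1)T₁(T₁⁻¹(q ⊗ c)) = Σ pq ⊗ c. The equality forces both products to be multiples of c and of a by
one scalar depending on b alone: this is ε(b). -/
theorem tmul_mul'_T₁_symm (H : MultiplierHopfStarAlgebra A) (a b c : A) :
    a ⊗ₜ[ℂ] LinearMap.mul' ℂ A (H.T₁.symm (b ⊗ₜ c)) =
      LinearMap.mul' ℂ A (H.T₂.symm (a ⊗ₜ b)) ⊗ₜ[ℂ] c := by
  have h1 : ∀ (a : A) (w : A ⊗[ℂ] A), (LinearMap.mul' ℂ A).lTensor A (TensorProduct.assoc ℂ A A A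
      (H.T₂.toLinearMap.rTensor A ((TensorProduct.assoc ℂ A A A).symm (a ⊗ₜ w)))) =
      lmul (leftLeg a) (H.T₁ w) := by
    intro a w
    induction w with
    | zero => simp
    | add u v hu hv => simp only [map_add, TensorProduct.tmul_add, hu, hv]
    | tmul p q => simpa using (leftLeg_T₁_eq H a p q).symm
  have h2 : ∀ u : A ⊗[ℂ] A, (LinearMap.mul' ℂ A ∘ₗ H.T₁.symm.toLinearMap).lTensor A
      (TensorProduct.assoc ℂ A A A (H.T₂ u ⊗ₜ c)) = LinearMap.mul' ℂ A u ⊗ₜ[ℂ] c := by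
    intro u
    induction u with
    | zero => simp
    | add u v hu hv => simp only [map_add, TensorProduct.add_tmul, hu, hv]
    | tmul p q =>
      rw [LinearMap.lTensor_comp_apply, lTensor_T₁_symm_T₂, h1]
      simp [lmul, leftLeg]
  rw [← h2]
  simp

theorem exists_isCounit (H : MultiplierHopfStarAlgebra A) [Nontrivial A] :
    ∃ ε : A →ₗ[ℂ] ℂ, IsCounit H ε := by
  obtain ⟨a₀, h₀⟩ := exists_ne (0 : A)
  obtain ⟨f, hf⟩ := exists_dual_eq_one h₀
  -- Since f(a₀) = 1, applying f to the first leg with a = a₀ isolates the scalar.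
  let ε : A →ₗ[ℂ] ℂ :=
    f ∘ₗ LinearMap.mul' ℂ A ∘ₗ H.T₂.symm.toLinearMap ∘ₗ TensorProduct.mk ℂ A A a₀
  have h1 : ∀ b c, LinearMap.mul' ℂ A (H.T₁.symm (b ⊗ₜ c)) = ε b • c := by
    intro b c
    simpa [sliceLeft_tmul, hf, ε] using congrArg (sliceLeft f) (tmul_mul'_T₁_symm H a₀ b c)
  have h2 : ∀ a b, LinearMap.mul' ℂ A (H.T₂.symm (a ⊗ₜ b)) = ε b • a := by
    intro a b
    have := congrArg (sliceRight f) (tmul_mul'_T₁_symm H a b a₀)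
    rw [h1] at this
    simpa [sliceRight_tmul, hf] using this.symm
  have h3 : sliceLeft ε = LinearMap.mul' ℂ A ∘ₗ H.T₁.symm.toLinearMap :=
    TensorProduct.ext' fun b c => by simp [sliceLeft_tmul, h1]
  have h4 : sliceRight ε = LinearMap.mul' ℂ A ∘ₗ H.T₂.symm.toLinearMap :=
    TensorProduct.ext' fun b c => by simp [sliceRight_tmul, h2]
  exact ⟨ε, fun a b => by simp [h3], fun a b => by simp [h4]⟩

theorem IsCounit.mul'_eq_sliceLeft {ε : A →ₗ[ℂ] ℂ} (hε : IsCounit H ε) (u : A ⊗[ℂ] A) :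
    LinearMap.mul' ℂ A u = sliceLeft ε (H.T₁ u) := by
  induction u with
  | zero => simp
  | add u v hu hv => simp only [map_add, hu, hv]
  | tmul p q => simp [hε.1]

/-- The bijection `a ⊗ b ⊗ c ↦ a₁ ⊗ b₁ ⊗ a₂b₂c`. -/
def doubleT₁ (H : MultiplierHopfStarAlgebra A) :
    A ⊗[ℂ] (A ⊗[ℂ] A) ≃ₗ[ℂ] A ⊗[ℂ] (A ⊗[ℂ] A) :=
  H.T₁.lTensor A ≪≫ₗ TensorProduct.leftComm ℂ A A A ≪≫ₗ H.T₁.lTensor A ≪≫ₗ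
    (TensorProduct.leftComm ℂ A A A).symm

theorem doubleT₁_ext {f g : A ⊗[ℂ] (A ⊗[ℂ] A) →ₗ[ℂ] A}
    (h : ∀ a b c, f (doubleT₁ H (a ⊗ₜ (b ⊗ₜ c))) = g (doubleT₁ H (a ⊗ₜ (b ⊗ₜ c)))) : f = g := by
  have : f ∘ₗ (doubleT₁ H).toLinearMap = g ∘ₗ (doubleT₁ H).toLinearMap := by
    ext a b c
    exact h a b c
  rwa [LinearMap.cancel_right (doubleT₁ H).surjective] at this

theorem lmul_comul_T₁ (H : MultiplierHopfStarAlgebra A) (a b c : A) :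
    lmul (H.comul a) (H.T₁ (b ⊗ₜ c)) = H.T₁ ((a * b) ⊗ₜ c) := by
  apply ofMul_injective H
  rw [ofMul_lmul H, H.T₁_spec, H.T₁_spec, map_mul, mul_assoc]

theorem rTensor_mul'_doubleT₁ (a b c : A) :
    (LinearMap.mul' ℂ A).rTensor A
      ((TensorProduct.assoc ℂ A A A).symm (doubleT₁ H (a ⊗ₜ (b ⊗ₜ c)))) =
      H.T₁ ((a * b) ⊗ₜ c) := by
  rw [← lmul_comul_T₁]
  simp only [doubleT₁, LinearEquiv.trans_apply, LinearEquiv.lTensor_tmul]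
  generalize H.T₁ (b ⊗ₜ c) = u
  induction u with
  | zero => simp
  | add u v hu hv => simp only [map_add, TensorProduct.tmul_add, hu, hv]
  | tmul p z =>
    rw [← rmul_leftLeg_T₁]
    simp only [TensorProduct.leftComm_tmul, LinearEquiv.lTensor_tmul]
    generalize H.T₁ (a ⊗ₜ z) = u
    induction u with
    | zero => simp
    | add u v hu hv => simp only [map_add, TensorProduct.tmul_add, hu, hv]
    | tmul r s => simp [rmul, leftLeg]

/-- Collapses the legs a₁ and a₂b₂c. It is used for M = ε ⊗ ι, where N is the product, and for M =
m(S ⊗ ι), where N a is the scalar ε(a). -/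
theorem lTensor_leftComm_doubleT₁ {M : A ⊗[ℂ] A →ₗ[ℂ] A} {N : A →ₗ[ℂ] A →ₗ[ℂ] A}
    (hM : ∀ a c, M (H.T₁ (a ⊗ₜ c)) = N a c) (a b c : A) :
    M.lTensor A (TensorProduct.leftComm ℂ A A A (doubleT₁ H (a ⊗ₜ (b ⊗ₜ c)))) =
      (N a).lTensor A (H.T₁ (b ⊗ₜ c)) := by
  simp only [doubleT₁, LinearEquiv.trans_apply, LinearEquiv.lTensor_tmul]
  generalize H.T₁ (b ⊗ₜ c) = u
  induction u with
  | zero => simp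
  | add u v hu hv => simp only [map_add, TensorProduct.tmul_add, hu, hv]
  | tmul p z =>
    rw [LinearEquiv.apply_symm_apply]
    simp [hM]

/-- On the spanning elements a₁ ⊗ b₁ ⊗ a₂b₂c the maps x ⊗ y ⊗ z ↦ ε(xy)z and ε(x)ε(y)z both give
abc. -/
theorem IsCounit.map_mul [Nontrivial A] {ε : A →ₗ[ℂ] ℂ} (hε : IsCounit H ε) (a b : A) :
    ε (a * b) = ε a * ε b := by
  have key : sliceLeft ε ∘ₗ (LinearMap.mul' ℂ A).rTensor A ∘ₗ
      (TensorProduct.assoc ℂ A A A).symm.toLinearMap =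
      sliceLeft ε ∘ₗ (sliceLeft ε).lTensor A ∘ₗ (TensorProduct.leftComm ℂ A A A).toLinearMap := by
    refine doubleT₁_ext (H := H) fun a b c => ?_
    simp only [LinearMap.comp_apply, LinearEquiv.coe_coe]
    rw [rTensor_mul'_doubleT₁, lTensor_leftComm_doubleT₁ (N := LinearMap.mul ℂ A)
      (fun a c => hε.1 a c), hε.1, mul_assoc, ← hε.1 b c]
    generalize H.T₁ (b ⊗ₜ c) = u
    induction u with
    | zero => simp
    | add u v hu hv => simp only [map_add, mul_add, hu, hv]
    | tmul p z => simp [sliceLeft_tmul, mul_smul_comm]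
  obtain ⟨c, hc⟩ := exists_ne (0 : A)
  have := LinearMap.congr_fun key (a ⊗ₜ (b ⊗ₜ c))
  simp only [LinearMap.comp_apply, LinearEquiv.coe_coe, TensorProduct.assoc_symm_tmul,
    LinearMap.rTensor_tmul, LinearMap.mul'_apply, TensorProduct.leftComm_tmul,
    LinearMap.lTensor_tmul, sliceLeft_tmul, smul_smul] at this
  rw [mul_comm (ε a)]
  exact smul_left_injective ℂ hc this

/-- `(ι ⊗ ε)(Δ(a)(1 ⊗ q)) = ε(q)a`. -/
theorem IsCounit.sliceRight_T₁ [Nontrivial A] {ε : A →ₗ[ℂ] ℂ} (hε : IsCounit H ε) (a q : A) :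
    sliceRight ε (H.T₁ (a ⊗ₜ q)) = ε q • a := by
  refine sub_eq_zero.1 (H.nondeg_left _ fun c => ?_)
  have h : ε ∘ₗ LinearMap.mulRight ℂ q = ε q • ε := LinearMap.ext fun x => by
    simp [hε.map_mul, mul_comm]
  have h' : ∀ u : A ⊗[ℂ] A, sliceRight (ε q • ε) u = ε q • sliceRight ε u := by
    intro u
    simp [sliceRight, LinearMap.lTensor_smul]
  rw [mul_sub, ← sliceRight_leftLeg, leftLeg_T₁, sliceRight_rmul_rightLeg, h, h', hε.2,
    mul_smul_comm, sub_self]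

/-- On the same spanning elements x ⊗ y ⊗ z ↦ S(xy)z gives ε(ab)c and S(y)S(x)z gives ε(a)ε(b)c. -/
theorem antipode_mul_of_isCounit [Nontrivial A] {ε : A →ₗ[ℂ] ℂ} (hε : IsCounit H ε)
    {S : A →ₗ[ℂ] A}
    (hS : ∀ a a' : A, LinearMap.mul' ℂ A (S.rTensor A (H.T₁ (a ⊗ₜ a'))) = ε a • a') (a b : A) :
    S (a * b) = S b * S a := by
  obtain ⟨M, hM⟩ : ∃ M, M = LinearMap.mul' ℂ A ∘ₗ S.rTensor A := ⟨_, rfl⟩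
  have hM' : ∀ a c, M (H.T₁ (a ⊗ₜ c)) = ε a • c := by simpa [hM] using hS
  have key : M ∘ₗ (LinearMap.mul' ℂ A).rTensor A ∘ₗ
      (TensorProduct.assoc ℂ A A A).symm.toLinearMap =
      M ∘ₗ M.lTensor A ∘ₗ (TensorProduct.leftComm ℂ A A A).toLinearMap := by
    refine doubleT₁_ext (H := H) fun a b c => ?_
    simp only [LinearMap.comp_apply, LinearEquiv.coe_coe]
    rw [rTensor_mul'_doubleT₁, lTensor_leftComm_doubleT₁
      (N := LinearMap.lsmul ℂ A ∘ₗ ε) (fun a c => by simpa using hM' a c)]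
    have h : ∀ u : A ⊗[ℂ] A, M (((LinearMap.lsmul ℂ A ∘ₗ ε) a).lTensor A u) =
        ε a • M u := by
      intro u
      induction u with
      | zero => simp
      | add u v hu hv => simp only [map_add, smul_add, hu, hv]
      | tmul p z => simp
    rw [h, hM', hM', hε.map_mul, mul_smul]
  refine sub_eq_zero.1 (H.nondeg_right _ fun c => ?_)
  have := LinearMap.congr_fun key (a ⊗ₜ (b ⊗ₜ c))
  simp only [LinearMap.comp_apply, LinearEquiv.coe_coe, TensorProduct.assoc_symm_tmul,
    LinearMap.rTensor_tmul, LinearMap.mul'_apply, TensorProduct.leftComm_tmul,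
    LinearMap.lTensor_tmul, hM] at this
  rw [sub_mul, this, mul_assoc, sub_self]

end CounitExistence


/-! ### The antipode, constructed from the left integral -/

section AntipodeExistence

variable {A : Type*} [NonUnitalRing A] [StarRing A] [Module ℂ A]
  [IsScalarTower ℂ A A] [SMulCommClass ℂ A A] [StarModule ℂ A] (G : AlgQuantumGroup A)

theorem AlgQuantumGroup.exists_φ_eq_one : ∃ a, G.φ a = 1 := by
  obtain ⟨a, ha⟩ : ∃ a, G.φ a ≠ 0 := by
    by_contra! h
    exact G.φ_ne_zero (LinearMap.ext h)
  exact ⟨(G.φ a)⁻¹ • a, by simp [ha]⟩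

theorem AlgQuantumGroup.nontrivial (G : AlgQuantumGroup A) : Nontrivial A := by
  obtain ⟨a, ha⟩ := G.exists_φ_eq_one
  exact ⟨a, 0, fun h => by simp [h] at ha⟩

/-- The map `c ⊗ x ↦ (ι ⊗ φ)(Δ(c)(1 ⊗ x))`. -/
def intT₁ : A ⊗[ℂ] A →ₗ[ℂ] A := sliceRight G.φ ∘ₗ G.T₁.toLinearMap

/-- The map `c ⊗ x ↦ (ι ⊗ φ)((1 ⊗ c)Δ(x))`. -/
def intT₃ : A ⊗[ℂ] A →ₗ[ℂ] A := sliceRight G.φ ∘ₗ T₃ G.toMultiplierHopfStarAlgebra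

theorem intT₁_apply (u : A ⊗[ℂ] A) : intT₁ G u = sliceRight G.φ (G.T₁ u) := rfl

theorem intT₃_apply (u : A ⊗[ℂ] A) :
    intT₃ G u = sliceRight G.φ (T₃ G.toMultiplierHopfStarAlgebra u) := rfl

theorem sliceRight_φ_T₄ (y x : A) :
    sliceRight G.φ (T₄ G.toMultiplierHopfStarAlgebra (y ⊗ₜ x)) = G.φ x • y := by
  refine sub_eq_zero.1 (G.nondeg_left _ fun c => ?_)
  rw [mul_sub, ← sliceRight_leftLeg, leftLeg_T₄, sliceRight_rmul_leftLeg, G.φ_invariant,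
    smul_mul_assoc, mul_smul_comm, sub_self]

theorem intT₁_surjective : Function.Surjective (intT₁ G) := by
  intro a
  obtain ⟨x, hx⟩ := G.exists_φ_eq_one
  exact ⟨G.T₁.symm (a ⊗ₜ x), by simp [intT₁_apply, sliceRight_tmul, hx]⟩

theorem intT₃_mul (c x y : A) : intT₃ G (c ⊗ₜ x) * y = sliceRight (G.φ ∘ₗ LinearMap.mulLeft ℂ c)
    (T₄ G.toMultiplierHopfStarAlgebra (y ⊗ₜ x)) := by
  rw [intT₃_apply, ← sliceRight_rmul_leftLeg, ← rightLeg_T₄, sliceRight_rightLeg]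

theorem mul_intT₁ (a c x : A) : a * intT₁ G (c ⊗ₜ x) = sliceRight (G.φ ∘ₗ LinearMap.mulRight ℂ x)
    (G.T₂ (a ⊗ₜ c)) := by
  rw [intT₁_apply, ← sliceRight_leftLeg, leftLeg_T₁, sliceRight_rmul_rightLeg]

/-- Coassociativity with φ applied to the third leg: both sides are ac₁ ⊗ c₂φ(c₃s). -/
theorem T₂_intT₁ (a c s : A) : G.T₂ (a ⊗ₜ intT₁ G (c ⊗ₜ s)) =
    (intT₁ G).lTensor A (TensorProduct.assoc ℂ A A A (G.T₂ (a ⊗ₜ c) ⊗ₜ s)) := by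
  have h := congrArg ((sliceRight G.φ).lTensor A) (G.coassoc a c s)
  rw [← LinearMap.lTensor_comp_apply] at h
  refine Eq.trans ?_ h.symm
  rw [intT₁_apply]
  generalize G.T₁ (c ⊗ₜ s) = w
  have h2 : ∀ (u : A ⊗[ℂ] A) (z : A), (sliceRight G.φ).lTensor A
      (TensorProduct.assoc ℂ A A A (u ⊗ₜ z)) = G.φ z • u := by
    intro u z
    induction u with
    | zero => simp
    | add u v hu hv => simp only [map_add, TensorProduct.add_tmul, smul_add, hu, hv]
    | tmul p q => simp [sliceRight_tmul]
  induction w with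
  | zero => simp
  | add u v hu hv => simp only [map_add, TensorProduct.tmul_add, hu, hv]
  | tmul p z =>
    simp only [TensorProduct.assoc_symm_tmul, LinearMap.rTensor_tmul, h2]
    simp [sliceRight_tmul]

/-- The map `w ↦ q ↦ Δ(q)w`. -/
def comulMul (H : MultiplierHopfStarAlgebra A) : A ⊗[ℂ] A →ₗ[ℂ] A →ₗ[ℂ] A ⊗[ℂ] A :=
  LinearMap.mk₂ ℂ (fun w q => lmul (H.comul q) w) (fun u v q => map_add _ u v)
    (fun r u q => map_smul _ r u) (fun w p q => by rw [map_add]; rfl)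
    (fun r w q => by rw [map_smul]; rfl)

theorem comulMul_apply (H : MultiplierHopfStarAlgebra A) (w : A ⊗[ℂ] A) (q : A) :
    comulMul H w q = lmul (H.comul q) w := rfl

/-- For w = r ⊗ s both sides are ac₁ ⊗ c₂rφ(c₃s). Writing this through Δ(c₂)w makes it linear in w,
so that w = Δ(x)(y ⊗ 1) may be inserted and Δ(c₂)Δ(x) = Δ(c₂x) used. -/
theorem leftLeg_T₁_intT₁ (a c : A) (w : A ⊗[ℂ] A) :
    lmul (leftLeg a) (G.T₁ (TensorProduct.comm ℂ A A
      ((intT₁ G ∘ₗ TensorProduct.mk ℂ A A c).lTensor A w))) =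
      (sliceRight G.φ ∘ₗ comulMul G.toMultiplierHopfStarAlgebra w).lTensor A
        (G.T₂ (a ⊗ₜ c)) := by
  induction w with
  | zero => simp only [map_zero, LinearMap.comp_zero, LinearMap.lTensor_zero, LinearMap.zero_apply]
  | add u v hu hv =>
    simp only [map_add, hu, hv, LinearMap.comp_add, LinearMap.lTensor_add, LinearMap.add_apply]
  | tmul r s =>
    simp only [LinearMap.lTensor_tmul, TensorProduct.comm_tmul, LinearMap.comp_apply,
      TensorProduct.mk_apply]
    rw [leftLeg_T₁, T₂_intT₁]
    generalize G.T₂ (a ⊗ₜ c) = u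
    induction u with
    | zero => simp
    | add u v hu hv => simp only [map_add, TensorProduct.add_tmul, hu, hv]
    | tmul p q =>
      simp only [TensorProduct.assoc_tmul, LinearMap.lTensor_tmul, LinearMap.comp_apply,
        comulMul_apply]
      rw [← rmul_leftLeg_T₁, sliceRight_rmul_leftLeg]
      simp [rmul, rightLeg, intT₁_apply]

/-- By left invariance, `Δ(c₁φ(c₂s))(1 ⊗ r) = c₁φ(c₂x) ⊗ y` if `r ⊗ s = Δ(x)(y ⊗ 1)`. -/
theorem T₁_intT₁ (c x y : A) :
    G.T₁ (TensorProduct.comm ℂ A A ((intT₁ G ∘ₗ TensorProduct.mk ℂ A A c).lTensor A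
      (T₄ G.toMultiplierHopfStarAlgebra (y ⊗ₜ x)))) = intT₁ G (c ⊗ₜ x) ⊗ₜ y := by
  refine tensor_ext_leftLeg G.toMultiplierHopfStarAlgebra fun a => ?_
  rw [leftLeg_T₁_intT₁]
  have h : lmul (leftLeg a) (intT₁ G (c ⊗ₜ x) ⊗ₜ[ℂ] y) = (a * intT₁ G (c ⊗ₜ x)) ⊗ₜ y := by
    simp [lmul, leftLeg]
  rw [h, mul_intT₁]
  generalize G.T₂ (a ⊗ₜ c) = u
  induction u with
  | zero => simp
  | add u v hu hv => simp only [map_add, TensorProduct.add_tmul, hu, hv]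
  | tmul p q =>
    simp [sliceRight_tmul, comulMul_apply, lmul_comul_T₄, sliceRight_φ_T₄, TensorProduct.smul_tmul]

variable {G}

theorem counit_intT₁ {ε : A →ₗ[ℂ] ℂ} (hε : IsCounit G.toMultiplierHopfStarAlgebra ε) (c x : A) :
    ε (intT₁ G (c ⊗ₜ x)) = G.φ (c * x) := by
  rw [intT₁_apply, ← tensorFun_eq_sliceRight, tensorFun_eq_sliceLeft, hε.1]

/-- Apply (ε ⊗ ι)T₁⁻¹ to `T₁_intT₁`: with Σ r ⊗ s = Δ(x)(y ⊗ 1) it yields Σ φ(cs)r = x₁φ(cx₂)y.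
Hence `intT₃ G u` depends on u only through `intT₁ G u`. -/
theorem intT₃_mul_eq_counit {ε : A →ₗ[ℂ] ℂ} (hε : IsCounit G.toMultiplierHopfStarAlgebra ε)
    (u : A ⊗[ℂ] A) (y : A) :
    intT₃ G u * y = sliceLeft ε (G.T₁.symm (intT₁ G u ⊗ₜ y)) := by
  induction u with
  | zero => simp
  | add u v hu hv => simp only [map_add, add_mul, TensorProduct.add_tmul, hu, hv]
  | tmul c x =>
    rw [← T₁_intT₁, LinearEquiv.symm_apply_apply, intT₃_mul]
    generalize T₄ G.toMultiplierHopfStarAlgebra (y ⊗ₜ x) = w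
    induction w with
    | zero => simp
    | add u v hu hv => simp only [map_add, hu, hv]
    | tmul r s => simp [sliceLeft_tmul, sliceRight_tmul, counit_intT₁ hε]

/-- S is `intT₃` composed with a linear section of the surjection `intT₁`; the choice of section is
immaterial by `intT₃_mul_eq_counit`. -/
theorem exists_antipode_left {ε : A →ₗ[ℂ] ℂ} (hε : IsCounit G.toMultiplierHopfStarAlgebra ε) :
    ∃ S : A →ₗ[ℂ] A, (∀ u, S (intT₁ G u) = intT₃ G u) ∧
      ∀ a y, S a * y = sliceLeft ε (G.T₁.symm (a ⊗ₜ y)) := by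
  obtain ⟨σ, hσ⟩ := (intT₁ G).exists_rightInverse_of_surjective
    (LinearMap.range_eq_top.2 (intT₁_surjective G))
  have hσ' : ∀ a, intT₁ G (σ a) = a := fun a => LinearMap.congr_fun hσ a
  have h : ∀ a y, (intT₃ G ∘ₗ σ) a * y = sliceLeft ε (G.T₁.symm (a ⊗ₜ y)) := fun a y => by
    rw [LinearMap.comp_apply, intT₃_mul_eq_counit hε, hσ']
  refine ⟨intT₃ G ∘ₗ σ, fun u => sub_eq_zero.1 (G.nondeg_right _ fun y => ?_), h⟩
  rw [sub_mul, h, intT₃_mul_eq_counit hε, sub_self]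

/-- The first identity is the hypothesis read through T₁. For the second, multiply by c on the right
and move T₁⁻¹ past T₂; the counit property then leaves a' m(T₁⁻¹(a ⊗ c)) = ε(a)a'c. -/
theorem isAntipode_of_left {H : MultiplierHopfStarAlgebra A} {ε : A →ₗ[ℂ] ℂ} (hε : IsCounit H ε)
    {S : A →ₗ[ℂ] A} (hS : ∀ a y, S a * y = sliceLeft ε (H.T₁.symm (a ⊗ₜ y))) :
    (∀ a a' : A, LinearMap.mul' ℂ A (S.rTensor A (H.T₁ (a ⊗ₜ a'))) = ε a • a') ∧
    ∀ a a' : A, LinearMap.mul' ℂ A (S.lTensor A (H.T₂ (a' ⊗ₜ a))) = ε a • a' := by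
  have h1 : ∀ u, LinearMap.mul' ℂ A (S.rTensor A u) = sliceLeft ε (H.T₁.symm u) := by
    intro u
    induction u with
    | zero => simp
    | add u v hu hv => simp only [map_add, hu, hv]
    | tmul p q => simp [hS]
  refine ⟨fun a a' => by simp [h1, sliceLeft_tmul], fun a a' => ?_⟩
  refine sub_eq_zero.1 (H.nondeg_right _ fun c => ?_)
  have h2 : ∀ u : A ⊗[ℂ] A, LinearMap.mul' ℂ A (S.lTensor A u) * c =
      LinearMap.mul' ℂ A ((sliceLeft ε ∘ₗ H.T₁.symm.toLinearMap).lTensor A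
        (TensorProduct.assoc ℂ A A A (u ⊗ₜ c))) := by
    intro u
    induction u with
    | zero => simp
    | add u v hu hv => simp only [map_add, add_mul, TensorProduct.add_tmul, hu, hv]
    | tmul p q => simp [← hS, mul_assoc]
  have h3 : ∀ w : A ⊗[ℂ] A, LinearMap.mul' ℂ A ((sliceLeft ε).lTensor A
      (TensorProduct.assoc ℂ A A A (H.T₂.toLinearMap.rTensor A
        ((TensorProduct.assoc ℂ A A A).symm (a' ⊗ₜ w))))) = a' * LinearMap.mul' ℂ A w := by
    intro w
    induction w with
    | zero => simp
    | add u v hu hv => simp only [map_add, TensorProduct.tmul_add, mul_add, hu, hv]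
    | tmul p q =>
      simp only [TensorProduct.assoc_symm_tmul, LinearMap.rTensor_tmul, LinearEquiv.coe_coe,
        LinearMap.mul'_apply]
      rw [← mul_assoc, ← hε.2 a' p]
      generalize H.T₂ (a' ⊗ₜ p) = u
      induction u with
      | zero => simp
      | add u v hu hv => simp only [map_add, TensorProduct.add_tmul, add_mul, hu, hv]
      | tmul r s => simp [sliceLeft_tmul, sliceRight_tmul, smul_mul_assoc]
  rw [sub_mul, h2, LinearMap.lTensor_comp_apply, lTensor_T₁_symm_T₂, h3, hε.mul'_eq_sliceLeft,
    LinearEquiv.apply_symm_apply, sliceLeft_tmul, mul_smul_comm, smul_mul_assoc, sub_self]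

/-! ### Positivity: φ is hermitian and S is bijective -/

/-- Polarisation: the values of φ at the squares of x + y and x + iy are real. -/
theorem φ_star_mul (x y : A) : G.φ (star (star x * y)) = star (G.φ (star x * y)) := by
  have hp : ∀ a, (G.φ (star a * a)).im = 0 := fun a => (Complex.nonneg_iff.1 (G.φ_positive a)).2.symm
  have hx := hp x
  have hy := hp y
  have h1 := hp (x + y)
  have h2 := hp (x + Complex.I • y)
  simp only [star_add, star_smul, add_mul, mul_add, map_add, map_smul, smul_mul_assoc,
    mul_smul_comm, smul_eq_mul, Complex.add_im, Complex.mul_im, Complex.I_re, Complex.I_im,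
    Complex.star_def, Complex.conj_I, Complex.neg_re, Complex.neg_im, Complex.mul_re, hx, hy]
    at h1 h2
  rw [star_mul, star_star]
  apply Complex.ext
  · simp only [Complex.star_def, Complex.conj_re]; linarith
  · simp only [Complex.star_def, Complex.conj_im]; linarith

theorem φ_star (a : A) : G.φ (star a) = star (G.φ a) := by
  have := G.nontrivial
  obtain ⟨ε, hε⟩ := exists_isCounit G.toMultiplierHopfStarAlgebra
  -- As m = (ε ⊗ ι)T₁ and ε ≠ 0, every element of A is a sum of products, to which `φ_star_mul`
  -- applies.
  obtain ⟨b, hb⟩ : ∃ b, ε b = 1 := by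
    obtain ⟨x, hx⟩ := G.exists_φ_eq_one
    obtain ⟨y, hy⟩ : ∃ y, ε y ≠ 0 := by
      by_contra! h
      have h0 : ε = 0 := LinearMap.ext h
      have h1 : ∀ u, LinearMap.mul' ℂ A u = 0 := fun u => by
        rw [hε.mul'_eq_sliceLeft, h0, sliceLeft_zero]
      have h2 : x = 0 := G.nondeg_left x fun c => by simpa using h1 (c ⊗ₜ x)
      simp [h2] at hx
    exact ⟨(ε y)⁻¹ • y, by simp [hy]⟩
  obtain ⟨u, rfl⟩ : ∃ u, LinearMap.mul' ℂ A u = a := ⟨G.T₁.symm (b ⊗ₜ a), by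
    rw [hε.mul'_eq_sliceLeft, LinearEquiv.apply_symm_apply, sliceLeft_tmul, hb, one_smul]⟩
  induction u with
  | zero => simp
  | add u v hu hv => simp only [map_add, star_add, hu, hv]
  | tmul p q => simpa using φ_star_mul (G := G) (star p) q

theorem star_intT₃ (c x : A) : star (intT₃ G (c ⊗ₜ x)) = intT₁ G (star x ⊗ₜ star c) := by
  rw [intT₁_apply, ← star_T₃, intT₃_apply]
  generalize T₃ G.toMultiplierHopfStarAlgebra (c ⊗ₜ x) = u
  induction u with
  | zero => simp
  | add u v hu hv => simp only [map_add, star_add, hu, hv]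
  | tmul p q => simp [sliceRight_tmul, φ_star]

theorem star_intT₁ (c x : A) : star (intT₁ G (c ⊗ₜ x)) = intT₃ G (star x ⊗ₜ star c) := by
  rw [← star_star (intT₃ G _), star_intT₃, star_star, star_star]

/-- The involution exchanges `intT₁` and `intT₃`, since φ is hermitian. The identity exhibits a ↦
S(a*)* as the inverse of S. -/
theorem antipode_star_antipode_star {S : A →ₗ[ℂ] A} (hS : ∀ u, S (intT₁ G u) = intT₃ G u) (a : A) :
    S (star (S a)) = star a := by
  obtain ⟨u, rfl⟩ := intT₁_surjective G a
  induction u with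
  | zero => simp
  | add u v hu hv => simp only [map_add, star_add, hu, hv]
  | tmul p q => rw [hS, star_intT₃, hS, star_intT₁]

variable (G) in
theorem exists_antipode : ∃ ε : A →ₗ[ℂ] ℂ, IsCounit G.toMultiplierHopfStarAlgebra ε ∧
    ∃ S : A ≃ₗ[ℂ] A, (∀ u, S (intT₁ G u) = intT₃ G u) ∧
      (∀ a a' : A, LinearMap.mul' ℂ A (S.toLinearMap.rTensor A (G.T₁ (a ⊗ₜ a'))) = ε a • a') ∧
      ∀ a a' : A, LinearMap.mul' ℂ A (S.toLinearMap.lTensor A (G.T₂ (a' ⊗ₜ a))) = ε a • a' := by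
  have := G.nontrivial
  obtain ⟨ε, hε⟩ := exists_isCounit G.toMultiplierHopfStarAlgebra
  obtain ⟨S, h1, h2⟩ := exists_antipode_left hε
  have h3 := antipode_star_antipode_star h1
  have hb : Function.Bijective S := by
    refine ⟨fun a b h => ?_, fun a => ⟨star (S (star a)), by rw [h3, star_star]⟩⟩
    exact star_injective (by rw [← h3 a, h, h3])
  exact ⟨ε, hε, LinearEquiv.ofBijective S hb, h1, isAntipode_of_left hε h2⟩

variable (G) in
theorem isAntipode_antipode : IsAntipode G.toMultiplierHopfStarAlgebra
    (antipode G.toMultiplierHopfStarAlgebra).toLinearMap := by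
  obtain ⟨ε, hε, S, -, hS⟩ := exists_antipode G
  have h : ∃ S : A ≃ₗ[ℂ] A, IsAntipode G.toMultiplierHopfStarAlgebra S.toLinearMap :=
    ⟨S, ε, hε, hS⟩
  rw [antipode, dif_pos h]
  exact h.choose_spec

variable (G) in
theorem antipode_intT₁ (u : A ⊗[ℂ] A) :
    antipode G.toMultiplierHopfStarAlgebra (intT₁ G u) = intT₃ G u := by
  obtain ⟨ε, hε, S, h, hS⟩ := exists_antipode G
  have := (isAntipode_antipode G).unique _ ⟨ε, hε, hS⟩
  rw [← h]
  exact LinearMap.congr_fun this _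

variable (G) in
theorem antipode_mul (a b : A) : antipode G.toMultiplierHopfStarAlgebra (a * b) =
    antipode G.toMultiplierHopfStarAlgebra b * antipode G.toMultiplierHopfStarAlgebra a := by
  have := G.nontrivial
  obtain ⟨ε, hε, hS, -⟩ := isAntipode_antipode G
  exact antipode_mul_of_isCounit hε hS a b

end AntipodeExistence


/-! ### Faithfulness of φ and local units -/

section Faithful

variable {A : Type*} [NonUnitalRing A] [StarRing A] [Module ℂ A]
  [IsScalarTower ℂ A A] [SMulCommClass ℂ A A] [StarModule ℂ A] (G : AlgQuantumGroup A)

/-- S is injective and carries the element to x₁φ(cx₂), a slice by the functional φ(c ·) = 0. -/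
theorem intT₁_eq_zero {c : A} (hc : ∀ x, G.φ (c * x) = 0) (x : A) : intT₁ G (c ⊗ₜ x) = 0 := by
  have h0 : G.φ ∘ₗ LinearMap.mulLeft ℂ c = 0 := LinearMap.ext hc
  refine (antipode G.toMultiplierHopfStarAlgebra).injective ?_
  rw [antipode_intT₁, map_zero]
  refine G.nondeg_right _ fun y => ?_
  rw [intT₃_mul, h0, sliceRight_zero]

/-- A left integral is faithful. -/
theorem φ_faithful {c : A} (hc : ∀ x, G.φ (c * x) = 0) : c = 0 := by
  have := G.nontrivial
  obtain ⟨ε, hε, -, hS⟩ := isAntipode_antipode G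
  set S := antipode G.toMultiplierHopfStarAlgebra with hSdef
  -- The second legs of (d ⊗ 1)Δ(c) again lie in the space of all c with φ(c ·) = 0.
  have hinv : ∀ (c : A), (∀ x, G.φ (c * x) = 0) → ∀ d x,
      sliceRight (G.φ ∘ₗ LinearMap.mulRight ℂ x) (G.T₂ (d ⊗ₜ c)) = 0 := fun c hc d x => by
    rw [← mul_intT₁, intT₁_eq_zero G hc, mul_zero]
  have hslice : ∀ (g : A →ₗ[ℂ] ℂ) (x : A) (u : A ⊗[ℂ] A), G.φ (sliceLeft g u * x) =
      g (sliceRight (G.φ ∘ₗ LinearMap.mulRight ℂ x) u) := fun g x u => by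
    rw [← tensorFun_eq_sliceRight, tensorFun_eq_sliceLeft]; rfl
  -- With (S(y) ⊗ 1)Δ(c) = Σ p ⊗ q, each φ(q ·) may be taken to vanish, so 0 = Σ φ(qS⁻¹(p)) =
  -- φ(S⁻¹(Σ pS(q))) = φ(S⁻¹(ε(c)S(y))) = ε(c)φ(y), where φ(y) = 1.
  have hcounit : ∀ c, (∀ x, G.φ (c * x) = 0) → ε c = 0 := by
    intro c hc
    obtain ⟨y, hy⟩ := G.exists_φ_eq_one
    have h1 : ∀ u : A ⊗[ℂ] A, LinearMap.mul' ℂ A (S.symm.toLinearMap.lTensor A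
        (TensorProduct.comm ℂ A A u)) = S.symm (LinearMap.mul' ℂ A (S.toLinearMap.lTensor A u)) := by
      intro u
      refine S.injective ?_
      rw [LinearEquiv.apply_symm_apply]
      induction u with
      | zero => simp
      | add u v hu hv => simp only [map_add, hu, hv]
      | tmul p q => simp [hSdef, antipode_mul]
    let L : A →ₗ[ℂ] A →ₗ[ℂ] ℂ := LinearMap.compr₂ (LinearMap.mul ℂ A) G.φ
    have h2 : ∀ u : A ⊗[ℂ] A, G.φ (LinearMap.mul' ℂ A (S.symm.toLinearMap.lTensor A
        (TensorProduct.comm ℂ A A u))) =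
        TensorProduct.lift (LinearMap.applyₗ ∘ₗ S.symm.toLinearMap) (L.lTensor A u) := by
      intro u
      induction u with
      | zero => simp
      | add u v hu hv => simp only [map_add, hu, hv]
      | tmul p q => simp [L]
    have h3 : L.lTensor A (G.T₂ (S y ⊗ₜ c)) = 0 := by
      refine eq_zero_of_sliceLeft _ fun g => LinearMap.ext fun x => ?_
      have h4 : ∀ u : A ⊗[ℂ] A, sliceLeft g (L.lTensor A u) x = G.φ (sliceLeft g u * x) := by
        intro u
        induction u with
        | zero => simp
        | add u v hu hv => simp only [map_add, add_mul, LinearMap.add_apply, hu, hv]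
        | tmul p q => simp [L, sliceLeft_tmul, smul_mul_assoc]
      rw [h4, hslice, hinv c hc, map_zero, LinearMap.zero_apply]
    have h5 := h2 (G.T₂ (S y ⊗ₜ c))
    rwa [h3, map_zero, h1, hS, map_smul, LinearEquiv.symm_apply_apply, map_smul, hy, smul_eq_mul,
      mul_one] at h5
  -- ε vanishes on every left slice of (d ⊗ 1)Δ(c), hence dc = (ι ⊗ ε)((d ⊗ 1)Δ(c)) = 0.
  refine G.nondeg_left _ fun d => ?_
  rw [← hε.2]
  refine (Module.forall_dual_apply_eq_zero_iff ℂ _).1 fun g => ?_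
  rw [← tensorFun_eq_sliceRight, tensorFun_eq_sliceLeft]
  exact hcounit _ fun x => by rw [hslice, hinv c hc, map_zero]

/-- Otherwise some ω vanishes on Ap but not at p. Then (ω ⊗ ι)(Δ(x)(p ⊗ 1)) is killed by every left
multiplication, so it is zero, while φ takes it to φ(x)ω(p) by left invariance. -/
theorem exists_mul_eq_self (G : AlgQuantumGroup A) (p : A) : ∃ f, f * p = p := by
  by_contra h
  have hp : p ∉ LinearMap.range (LinearMap.mulRight ℂ p) := fun ⟨f, hf⟩ => h ⟨f, hf⟩
  obtain ⟨ω, hω, hker⟩ := Submodule.exists_le_ker_of_notMem hp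
  obtain ⟨x, hx⟩ := G.exists_φ_eq_one
  have h0 : ω ∘ₗ LinearMap.mulRight ℂ p = 0 :=
    LinearMap.ext fun c => hker (LinearMap.mem_range_self _ c)
  have h1 : sliceLeft ω (T₄ G.toMultiplierHopfStarAlgebra (p ⊗ₜ x)) = 0 :=
    G.nondeg_left _ fun c => by
      rw [← sliceLeft_rightLeg, rightLeg_T₄, sliceLeft_rmul_leftLeg, h0, sliceLeft_zero]
  apply hω
  rw [← one_smul ℂ p, ← hx, ← sliceRight_φ_T₄, ← tensorFun_eq_sliceRight, tensorFun_eq_sliceLeft,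
    h1, map_zero]

/-- Otherwise some ω with ω(a) ≠ 0 vanishes on all a₁φ(a₂q). Faithfulness gives ω(a₁)a₂q = 0 for
every q, and applying ε gives ω(a)ε(q) = 0. -/
theorem exists_intT₁_eq_self (a : A) : ∃ q, intT₁ G (a ⊗ₜ q) = a := by
  by_contra h
  have ha : a ∉ LinearMap.range (intT₁ G ∘ₗ TensorProduct.mk ℂ A A a) := fun ⟨q, hq⟩ => h ⟨q, hq⟩
  obtain ⟨ω, hω, hker⟩ := Submodule.exists_le_ker_of_notMem ha
  have := G.nontrivial
  obtain ⟨ε, hε, -⟩ := isAntipode_antipode G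
  have h0 : ∀ q, ω (intT₁ G (a ⊗ₜ q)) = 0 := fun q => hker (LinearMap.mem_range_self _ q)
  have h1 : ∀ q, sliceLeft ω (G.T₁ (a ⊗ₜ q)) = 0 := fun q => φ_faithful G fun x => by
    rw [← sliceLeft_rmul_rightLeg]
    have : rmul (rightLeg x) (G.T₁ (a ⊗ₜ q)) = G.T₁ (a ⊗ₜ (q * x)) := by
      refine tensor_ext_leftLeg G.toMultiplierHopfStarAlgebra fun c => ?_
      have h2 : ∀ u : A ⊗[ℂ] A, lmul (leftLeg c) (rmul (rightLeg x) u) =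
          rmul (rightLeg x) (lmul (leftLeg c) u) := by
        intro u
        induction u with
        | zero => simp
        | add u v hu hv => simp only [map_add, hu, hv]
        | tmul p q => simp [lmul, rmul, leftLeg, rightLeg]
      rw [h2, leftLeg_T₁, leftLeg_T₁]
      generalize G.T₂ (c ⊗ₜ a) = u
      induction u with
      | zero => simp
      | add u v hu hv => simp only [map_add, hu, hv]
      | tmul p q => simp [rmul, rightLeg, mul_assoc]
    rw [this, ← tensorFun_eq_sliceLeft, tensorFun_eq_sliceRight]
    exact h0 _
  obtain ⟨q, hq⟩ : ∃ q, ε q ≠ 0 := by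
    by_contra! h
    have hε0 : ε = 0 := LinearMap.ext h
    exact hω (by
      have : a = 0 := G.nondeg_left a fun c => by rw [← hε.2, hε0, sliceRight_zero]
      rw [this, map_zero])
  have h2 := congrArg ω (hε.sliceRight_T₁ a q)
  rw [← tensorFun_eq_sliceRight, tensorFun_eq_sliceLeft, h1, map_zero, map_smul, smul_eq_mul] at h2
  exact (mul_ne_zero hq hω) h2.symm

end Faithful

/-! ### The operators λ and the two formulas -/

section Convolution

variable {A : Type*} [NonUnitalRing A] [StarRing A] [Module ℂ A]
  [IsScalarTower ℂ A A] [SMulCommClass ℂ A A] [StarModule ℂ A] (G : AlgQuantumGroup A)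

/-- c₁φ(c₂q) involves q only through φ(· q), so the chosen representative does not matter. -/
theorem intT₁_rep (a q : A) : intT₁ G (a ⊗ₜ rep (fourier G q)) = intT₁ G (a ⊗ₜ q) := by
  have h : fourierMap G (rep (fourier G q)) = fourierMap G q :=
    congrArg Subtype.val (fourier_rep (fourier G q))
  refine sub_eq_zero.1 (G.nondeg_left _ fun c => ?_)
  rw [mul_sub, mul_intT₁, mul_intT₁]
  exact sub_eq_zero.2 (congrArg (fun f => sliceRight f (G.T₂ (c ⊗ₜ a))) h)

theorem conv_eq (ω : A →ₗ[ℂ] ℂ) (e : DualSpace G) (a : A) :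
    conv G ω e a = ω (intT₁ G (a ⊗ₜ rep e)) :=
  tensorFun_eq_sliceRight _ _ _

theorem conv_fourier (ω : A →ₗ[ℂ] ℂ) (q a : A) :
    conv G ω (fourier G q) a = ω (intT₁ G (a ⊗ₜ q)) := by
  rw [conv_eq, intT₁_rep]

theorem exists_dual_cover (a : A) :
    ∃ e : DualSpace G, ∀ b : DualSpace G, evalAt a (dualMul b e) = evalAt a b := by
  obtain ⟨q, hq⟩ := exists_intT₁_eq_self G a
  exact ⟨fourier G q, fun b => (conv_fourier G b.1 q a).trans (congrArg b.1 hq)⟩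

/-- Testing the cover against b = F(x) for all x and using faithfulness turns a condition on
functionals into an equation in A. -/
theorem intT₁_rep_of_cover {a : A} {e : DualSpace G}
    (he : ∀ b : DualSpace G, evalAt a (dualMul b e) = evalAt a b) : intT₁ G (a ⊗ₜ rep e) = a := by
  refine sub_eq_zero.1 (φ_faithful G fun x => ?_)
  have h : G.φ (intT₁ G (a ⊗ₜ rep e) * x) = G.φ (a * x) :=
    (conv_eq G (fourier G x).1 e a).symm.trans (he (fourier G x))
  rw [sub_mul, map_sub, h, sub_self]

theorem sliceLeft_dualComul (a : A) (y e : DualSpace G) (x : A) :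
    (sliceLeft (evalAt a) (dualComul y e)).1 x = y.1 (x * intT₁ G (a ⊗ₜ rep e)) := by
  have h := (exists_dualComul G y e).choose_spec a x
  rw [tensorFun_eq_sliceLeft, conv_eq] at h
  exact h

theorem isDualConvolution_iff {a r : A} {z : DualSpace G} :
    IsDualConvolution G a (fourier G r) z ↔ z = fourier G (a * r) := by
  have key : ∀ e : DualSpace G, (∀ b : DualSpace G, evalAt a (dualMul b e) = evalAt a b) →
      sliceLeft (evalAt a) (dualComul (fourier G r) e) = fourier G (a * r) := by
    intro e he
    refine Subtype.ext (LinearMap.ext fun x => ?_)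
    rw [sliceLeft_dualComul, intT₁_rep_of_cover G he]
    exact congrArg G.φ (mul_assoc x a r)
  constructor
  · rintro ⟨e, he, rfl⟩
    exact key e he
  · rintro rfl
    obtain ⟨e, he⟩ := exists_dual_cover G a
    exact ⟨e, he, (key e he).symm⟩

theorem existsUnique_isDualConvolution (a : A) (y : DualSpace G) :
    ∃! z, IsDualConvolution G a y z := by
  rw [← fourier_rep y]
  exact ⟨_, (isDualConvolution_iff G).2 rfl, fun z hz => (isDualConvolution_iff G).1 hz⟩

theorem fourier_mulOp (a x : A) : fourier G (mulOp a x) = dualLam a (fourier G x) := by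
  have h : ∃ z, IsDualConvolution G a (fourier G x) z := (existsUnique_isDualConvolution G a _).exists
  rw [dualLam, dif_pos h]
  exact ((isDualConvolution_iff G).1 h.choose_spec).symm

theorem exists_cover (b : DualSpace G) : ∃ e : A, ∀ a : A,
    b.1 ((antipode G.toMultiplierHopfStarAlgebra).symm (e * a)) =
      b.1 ((antipode G.toMultiplierHopfStarAlgebra).symm a) := by
  obtain ⟨_, p, rfl⟩ := b
  obtain ⟨f, hf⟩ := exists_mul_eq_self G p
  -- For b = φ(· p) and fp = p take e = S(f): S⁻¹(S(f)a) = S⁻¹(a)f, and f is absorbed by p.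
  refine ⟨antipode G.toMultiplierHopfStarAlgebra f, fun a => ?_⟩
  have h : (antipode G.toMultiplierHopfStarAlgebra).symm
      (antipode G.toMultiplierHopfStarAlgebra f * a) =
      (antipode G.toMultiplierHopfStarAlgebra).symm a * f := by
    rw [LinearEquiv.symm_apply_eq, antipode_mul, LinearEquiv.apply_symm_apply]
  rw [h]
  simp [fourierMap, mul_assoc, hf]

variable {G} in
-- The right-hand side no longer contains e; non-degeneracy then makes z independent of the cover.
theorem IsConvolution.mul_eq {b : DualSpace G} {x z : A} (h : IsConvolution G b x z) (y : A) :
    z * y = sliceLeft (b.1 ∘ₗ (antipode G.toMultiplierHopfStarAlgebra).symm.toLinearMap)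
      (G.T₁ (x ⊗ₜ y)) := by
  obtain ⟨e, he, rfl⟩ := h
  rw [← sliceLeft_rmul_rightLeg, ← leftLeg_T₁, sliceLeft_leftLeg]
  congr 2
  exact LinearMap.ext he

variable {G} in
-- Strong left invariance: φ(cz) = b(S⁻¹(e x₁φ(cx₂))), the cover e drops out, and x₁φ(cx₂) =
-- S(c₁φ(c₂x)).
theorem IsConvolution.φ_mul {b : DualSpace G} {x z : A} (h : IsConvolution G b x z) (c : A) :
    G.φ (c * z) = b.1 (intT₁ G (c ⊗ₜ x)) := by
  obtain ⟨e, he, rfl⟩ := h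
  rw [← sliceLeft_rightLeg, rightLeg_T₂, ← tensorFun_eq_sliceLeft, tensorFun_eq_sliceRight,
    sliceRight_leftLeg, ← intT₃_apply, ← antipode_intT₁]
  exact (he _).trans (congrArg b.1 (LinearEquiv.symm_apply_apply _ _))

theorem existsUnique_isConvolution (b : DualSpace G) (x : A) : ∃! z, IsConvolution G b x z := by
  obtain ⟨e, he⟩ := exists_cover G b
  have h : IsConvolution G b x _ := ⟨e, he, rfl⟩
  refine ⟨_, h, fun z hz => sub_eq_zero.1 (G.nondeg_right _ fun y => ?_)⟩
  rw [sub_mul, hz.mul_eq, h.mul_eq, sub_self]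

theorem fourier_lam (b : DualSpace G) (x : A) :
    fourier G (lam b x) = dualMulOp b (fourier G x) := by
  have h : ∃ z, IsConvolution G b x z := (existsUnique_isConvolution G b x).exists
  rw [lam, dif_pos h]
  refine Subtype.ext (LinearMap.ext fun c => ?_)
  exact (h.choose_spec.φ_mul c).trans (conv_fourier G b.1 x c).symm

end Convolution

end QGroup

end

theorem proposition3p5 {A : Type*} [NonUnitalRing A] [StarRing A] [Module ℂ A]
    [IsScalarTower ℂ A A] [SMulCommClass ℂ A A] [StarModule ℂ A] (G : QGroup.AlgQuantumGroup A) :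
    QGroup.IsAntipode G.toMultiplierHopfStarAlgebra
        (QGroup.antipode G.toMultiplierHopfStarAlgebra).toLinearMap ∧
      (∀ (b : QGroup.DualSpace G) (x : A), ∃! z, QGroup.IsConvolution G b x z) ∧
      (∀ (a : A) (y : QGroup.DualSpace G), ∃! z, QGroup.IsDualConvolution G a y z) ∧
      (∀ a x : A, QGroup.fourier G (QGroup.mulOp a x) = QGroup.dualLam a (QGroup.fourier G x)) ∧
      ∀ (b : QGroup.DualSpace G) (x : A),
        QGroup.fourier G (QGroup.lam b x) = QGroup.dualMulOp b (QGroup.fourier G x) :=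
  ⟨QGroup.isAntipode_antipode G, QGroup.existsUnique_isConvolution G,
    QGroup.existsUnique_isDualConvolution G, QGroup.fourier_mulOp G, QGroup.fourier_lam G⟩
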